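/- Let $n\ge 2$, let $(M,\omega)$ be a symplectic manifold of real dimension $2n$, and let $J$ be an $\omega$-compatible almost complex structure on $M$. Let $B(\rho)\subset\mathbb{C}^n$ be the closed ball of radius $\rho>0$ around $0$, and let $\iota:(B(\rho),\omega_0)\to(M,\omega)$ be a symplectic embedding (a smooth embedding of a neighbourhood of $B(\rho)$ with $\iota^*\omega=\omega_0$ on $B(\rho)$) such that $\iota^*J=J_0$ on $B(\rho)$, where $\omega_0$ and $J_0$ are the standard symplectic form and the standard complex structure of $\mathbb{C}^n$. Put $x_0=\iota(0)$, and let $L\subset M$ be a Lagrangian submanifold with $L\cap\iota(B(\rho))=\emptyset$. Let $\pi:\widetilde M\to M$ be the blow up of $M$ at $x_0$, that is, the smooth manifold obtained by gluing $M\setminus\{x_0\}$ to $\{(z,\ell)\in\mathbb{C}^n\times\mathbb{C}P^{n-1}: z\in\ell,\ |z|<\rho\}$ along $\iota(z)\sim(z,\mathbb{C}z)$ for $0<|z|<\rho$, with $\pi$ the identity on $M\setminus\{x_0\}$ and $\pi(z,\ell)=\iota(z)$; let $E=\pi^{-1}(x_0)$ be the exceptional divisor, and $\widetilde L=\pi^{-1}(L)$.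 There is exactly one almost complex structure $\widetilde J$ on $\widetilde M$ for which $\pi$ is $(\widetilde J,J)$-holomorphic. Let $D\subset\mathbb{C}$ be the closed unit disk. For each nonconstant $J$-holomorphic disk $u:(D,\partial D)\to(M,L)$ (smooth up to the boundary) there is a unique $\widetilde J$-holomorphic disk $\widetilde u:(D,\partial D)\to(\widetilde M,\widetilde L)$ such that $\pi\circ\widetilde u=u$. Moreover, $u^{-1}(x_0)$ is finite, $u^{-1}(x_0)=\{z_1,\dots,z_r\}$. Let $k_j$ be the order of vanishing at $z_j$ of the $\mathbb{C}^n$-valued function $\iota^{-1}\circ u$, which is holomorphic near $z_j$; that is, $\iota^{-1}(u(z))=(z-z_j)^{k_j}h_j(z)$ near $z_j$ with $h_j$ holomorphic and $h_j(z_j)\neq 0$. Then every $k_j$ is finite, and, if $k=k_1+\dots+k_r$ is the multiplicity of $u$ at $x_0$ ($k=0$ if $x_0\notin u(D)$), the intersection number of $\widetilde u$ with $E$ is $\widetilde u\cdot E=k$. Here $\widetilde u\cdot E$ is the sum of the local intersection indices at the finitely many points of $\widetilde u^{-1}(E)$: the index at $z$ is the winding number around $0$ of the image of a small positively oriented circle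 around $z$ under $f\circ\widetilde u$, for any local defining function $f$ of $E$ near $\widetilde u(z)$ (a smooth $\mathbb{C}$-valued function, with $E=f^{-1}(0)$ near $\widetilde u(z)$ and $df$ onto along $E$) that is compatible with the orientation of the normal bundle of $E$ given by $\widetilde J$. -/

import Mathlib

open Set Filter Topology Bundle
open scoped Manifold ContDiff

/-- The space `ℂⁿ` with its Euclidean norm.  It is also the real `2n`-dimensional vector space on
which all manifolds below are modelled (with `𝓘(ℝ, Cn n)`, that is, as real manifolds). -/
abbrev Cn (n : ℕ) : Type := EuclideanSpace ℂ (Fin n)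

section AlmostComplex

variable (n : ℕ) (X : Type*) [TopologicalSpace X] [ChartedSpace (Cn n) X]
  [IsManifold 𝓘(ℝ, Cn n) ∞ X]

/-- A smooth almost complex structure on a smooth real `2n`-manifold: a smooth section `J` of
`End(TX)` with `J² = -1`. -/
@[ext]
structure AlmostComplexStructure where
  toFun : ∀ x : X, TangentSpace 𝓘(ℝ, Cn n) x →L[ℝ] TangentSpace 𝓘(ℝ, Cn n) x
  sq : ∀ x v, toFun x (toFun x v) = -v
  smooth : ContMDiff 𝓘(ℝ, Cn n) (𝓘(ℝ, Cn n).prod 𝓘(ℝ, Cn n →L[ℝ] Cn n)) ∞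
    (fun x ↦ TotalSpace.mk' (Cn n →L[ℝ] Cn n)
      (E := fun y : X ↦ TangentSpace 𝓘(ℝ, Cn n) y →L[ℝ] TangentSpace 𝓘(ℝ, Cn n) y) x (toFun x))

/-- A symplectic form on a smooth real `2n`-manifold: a smooth, alternating, nondegenerate, closed
`2`-form.  Closedness is `dΩ(a, b, c) = 0` for constant vector fields `a, b, c` in each chart. -/
structure SymplecticForm where
  toFun : ∀ x : X, TangentSpace 𝓘(ℝ, Cn n) x →L[ℝ] TangentSpace 𝓘(ℝ, Cn n) x →L[ℝ] ℝ
  alternating : ∀ x v, toFun x v v = 0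
  nondegenerate : ∀ x v, (∀ w, toFun x v w = 0) → v = 0
  smooth : ContMDiff 𝓘(ℝ, Cn n) (𝓘(ℝ, Cn n).prod 𝓘(ℝ, Cn n →L[ℝ] Cn n →L[ℝ] ℝ)) ∞
    (fun x ↦ TotalSpace.mk' (Cn n →L[ℝ] Cn n →L[ℝ] ℝ)
      (E := fun y : X ↦ TangentSpace 𝓘(ℝ, Cn n) y →L[ℝ] TangentSpace 𝓘(ℝ, Cn n) y →L[ℝ] ℝ)
      x (toFun x))
  closed : ∀ e ∈ atlas (Cn n) X, ∀ y ∈ e.target, ∀ a b c : Cn n,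
    let Ωe : Cn n → Cn n → Cn n → ℝ := fun p v w ↦
      toFun (e.symm p) (mfderiv 𝓘(ℝ, Cn n) 𝓘(ℝ, Cn n) e.symm p v)
        (mfderiv 𝓘(ℝ, Cn n) 𝓘(ℝ, Cn n) e.symm p w)
    fderiv ℝ (fun p ↦ Ωe p b c) y a + fderiv ℝ (fun p ↦ Ωe p c a) y b
      + fderiv ℝ (fun p ↦ Ωe p a b) y c = 0

variable {n X}

/-- `J` is `Ω`-compatible: `Ω(·, J·)` is positive definite and `J` preserves `Ω`. -/
def SymplecticForm.Compatible (Ω : SymplecticForm n X) (J : AlmostComplexStructure n X) : Prop :=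
  (∀ x v, v ≠ 0 → 0 < Ω.toFun x v (J.toFun x v)) ∧
  ∀ x v w, Ω.toFun x (J.toFun x v) (J.toFun x w) = Ω.toFun x v w

/-- `L` is a Lagrangian submanifold: an embedded `n`-dimensional submanifold (in suitable charts it
is a real `n`-dimensional linear subspace) on whose tangent spaces `Ω` vanishes. -/
def SymplecticForm.IsLagrangian (Ω : SymplecticForm n X) (L : Set X) : Prop :=
  ∀ x ∈ L, ∃ e ∈ IsManifold.maximalAtlas 𝓘(ℝ, Cn n) ∞ X, x ∈ e.source ∧
    ∃ V : Submodule ℝ (Cn n), Module.finrank ℝ V = n ∧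
      (∀ y ∈ e.source, y ∈ L ↔ e y ∈ V) ∧
      ∀ y ∈ e.target, y ∈ V → ∀ v ∈ V, ∀ w ∈ V,
        Ω.toFun (e.symm y) (mfderiv 𝓘(ℝ, Cn n) 𝓘(ℝ, Cn n) e.symm y v)
          (mfderiv 𝓘(ℝ, Cn n) 𝓘(ℝ, Cn n) e.symm y w) = 0

/-- A smooth map `f` is `(J, J')`-holomorphic: `df ∘ J = J' ∘ df`. -/
def IsHolomorphicMap {Y : Type*} [TopologicalSpace Y] [ChartedSpace (Cn n) Y]
    [IsManifold 𝓘(ℝ, Cn n) ∞ Y] (J : AlmostComplexStructure n X)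
    (J' : AlmostComplexStructure n Y) (f : X → Y) : Prop :=
  ContMDiff 𝓘(ℝ, Cn n) 𝓘(ℝ, Cn n) ∞ f ∧
  ∀ x v, mfderiv 𝓘(ℝ, Cn n) 𝓘(ℝ, Cn n) f x (J.toFun x v) =
    J'.toFun (f x) (mfderiv 𝓘(ℝ, Cn n) 𝓘(ℝ, Cn n) f x v)

/-- The closed unit disk `D` in `ℂ`. -/
def unitDisk : Set ℂ := Metric.closedBall 0 1

/-- A `J`-holomorphic disk `(D, ∂D) → (X, L)`: a map that is smooth up to the boundary, satisfies
`du ∘ i = J ∘ du` on `D`, and sends `∂D` into `L`.  Only the values of `u` on `D` matter. -/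
structure IsHolomorphicDisk (J : AlmostComplexStructure n X) (L : Set X) (u : ℂ → X) : Prop where
  smooth : ContMDiffOn 𝓘(ℝ, ℂ) 𝓘(ℝ, Cn n) ∞ u unitDisk
  holomorphic : ∀ z ∈ unitDisk, ∀ v : ℂ,
    mfderivWithin 𝓘(ℝ, ℂ) 𝓘(ℝ, Cn n) u unitDisk z (Complex.I * v : ℂ) =
      J.toFun (u z) (mfderivWithin 𝓘(ℝ, ℂ) 𝓘(ℝ, Cn n) u unitDisk z v)
  boundary : ∀ z ∈ Metric.sphere (0 : ℂ) 1, u z ∈ L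

/-! ### Intersection number of a disk with a cooriented submanifold of codimension two -/

/-- The loop `γ : [0, 2π] → ℂ \ {0}` (extended periodically to `ℝ`) winds `m` times around `0`: it
has a continuous logarithm that increases by `2πi m`. -/
def HasWindingNumber (γ : ℝ → ℂ) (m : ℤ) : Prop :=
  ∃ l : ℝ → ℂ, Continuous l ∧ (∀ t, γ t = Complex.exp (l t)) ∧
    l (2 * Real.pi) = l 0 + 2 * Real.pi * Complex.I * m

/-- `f` is an oriented smooth local defining function near `x` of the subset `E` (a submanifold of
real codimension two): near `x` one has `E = f⁻¹(0)`, `df` is onto `ℂ` along `E`, and the induced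
isomorphism of the normal bundle of `E` with `ℂ` preserves the orientations (the normal bundle
being oriented by `J`: each normal vector `v` forms a positive basis `(v, J v)`). -/
def IsDefiningFunctionAt (J : AlmostComplexStructure n X) (E : Set X) (x : X) (f : X → ℂ) : Prop :=
  ∃ U : Set X, IsOpen U ∧ x ∈ U ∧ ContMDiffOn 𝓘(ℝ, Cn n) 𝓘(ℝ, ℂ) ∞ f U ∧
    (∀ y ∈ U, y ∈ E ↔ f y = 0) ∧
    ∀ y ∈ U, y ∈ E →
      let A : Cn n → ℂ := fun v ↦ mfderiv 𝓘(ℝ, Cn n) 𝓘(ℝ, ℂ) f y v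
      Function.Surjective A ∧
      ∀ v : Cn n, A v ≠ 0 → 0 < ((starRingEnd ℂ) (A v) * A (J.toFun y v)).im

/-- The map `u` has local intersection index `m` with `E` at the interior point `z` of the disk:
`E` has an oriented local defining function at `u z`, and for each such function `f` the image
under `f ∘ u` of every small circle around `z` winds `m` times around `0`. -/
def HasLocalIntersectionIndex (J : AlmostComplexStructure n X) (E : Set X) (u : ℂ → X) (z : ℂ)
    (m : ℤ) : Prop :=
  (∃ f, IsDefiningFunctionAt J E (u z) f) ∧
  ∀ f, IsDefiningFunctionAt J E (u z) f →
    ∀ᶠ r in 𝓝[>] (0 : ℝ), HasWindingNumber (fun t ↦ f (u (circleMap z r t))) m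

/-- The algebraic intersection number `u · E` of a disk `u`, whose boundary does not meet `E`, is
defined and equals `m`: there are finitely many intersection points, and their local intersection
indices add up to `m`. -/
def HasIntersectionNumber (J : AlmostComplexStructure n X) (E : Set X) (u : ℂ → X) (m : ℤ) :
    Prop :=
  (∀ z ∈ Metric.sphere (0 : ℂ) 1, u z ∉ E) ∧
  ∃ S : Finset ℂ, (∀ z, z ∈ S ↔ z ∈ unitDisk ∧ u z ∈ E) ∧
    ∃ i : ℂ → ℤ, (∀ z ∈ S, HasLocalIntersectionIndex J E u z (i z)) ∧ ∑ z ∈ S, i z = m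

/-- A smooth embedding `ι` of the closed ball `B(ρ)` of radius `ρ > 0` of `ℂⁿ` into a `2n`-manifold:
a diffeomorphism from an open neighbourhood of `B(ρ)` onto an open set. -/
structure BallEmbedding (n : ℕ) (X : Type*) [TopologicalSpace X] [ChartedSpace (Cn n) X] where
  map : OpenPartialHomeomorph (Cn n) X
  radius : ℝ
  radius_pos : 0 < radius
  closedBall_subset : Metric.closedBall 0 radius ⊆ map.source
  smooth : ContMDiffOn 𝓘(ℝ, Cn n) 𝓘(ℝ, Cn n) ∞ map map.source
  smooth_symm : ContMDiffOn 𝓘(ℝ, Cn n) 𝓘(ℝ, Cn n) ∞ map.symm map.target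

namespace BallEmbedding

/-- `ι*Ω = ω₀` on `B(ρ)`, with `ω₀(v, w) = ∑ dxⱼ ∧ dyⱼ (v, w) = Im ∑ conj(vⱼ) wⱼ`. -/
def IsSymplectic (ι : BallEmbedding n X) (Ω : SymplecticForm n X) : Prop :=
  ∀ z ∈ Metric.closedBall (0 : Cn n) ι.radius, ∀ v w : Cn n,
    Ω.toFun (ι.map z) (mfderiv 𝓘(ℝ, Cn n) 𝓘(ℝ, Cn n) ι.map z v)
      (mfderiv 𝓘(ℝ, Cn n) 𝓘(ℝ, Cn n) ι.map z w) = (inner ℂ v w).im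

/-- `ι*J = J₀` on `B(ρ)`, with `J₀` the multiplication by `i`. -/
def PullsBackToStandard (ι : BallEmbedding n X) (J : AlmostComplexStructure n X) : Prop :=
  ∀ z ∈ Metric.closedBall (0 : Cn n) ι.radius, ∀ v : Cn n,
    mfderiv 𝓘(ℝ, Cn n) 𝓘(ℝ, Cn n) ι.map z (Complex.I • v : Cn n) =
      J.toFun (ι.map z) (mfderiv 𝓘(ℝ, Cn n) 𝓘(ℝ, Cn n) ι.map z v)

end BallEmbedding

end AlmostComplex

/-! ### The one-point blow up -/

noncomputable section BlowUp

namespace BallEmbedding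

variable {n : ℕ} {X : Type*} [TopologicalSpace X] [ChartedSpace (Cn n) X]

/-- The base point `x₀ = ι(0)`. -/
def center (ι : BallEmbedding n X) : X := ι.map 0

theorem zero_mem_source (ι : BallEmbedding n X) : (0 : Cn n) ∈ ι.map.source :=
  ι.closedBall_subset (by simpa using ι.radius_pos.le)

theorem mem_source (ι : BallEmbedding n X) {z : Cn n} (hz : ‖z‖ < ι.radius) : z ∈ ι.map.source :=
  ι.closedBall_subset (by simpa using hz.le)

theorem map_ne_center (ι : BallEmbedding n X) {z : Cn n} (hz : z ≠ 0 ∧ ‖z‖ < ι.radius) :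
    ι.map z ≠ ι.center := fun h ↦
  hz.1 (ι.map.injOn (ι.mem_source hz.2) ι.zero_mem_source h)

end BallEmbedding

section Points

variable {n : ℕ} {X : Type*} [TopologicalSpace X] [ChartedSpace (Cn n) X]

/-- The underlying set of the blow up of `X` at `x₀ = ι(0)`: the point `x₀` is replaced by the
projective space of lines in `ℂⁿ`.  The gluing of `X \ {x₀}` with
`{(z, ℓ) ∈ ℂⁿ × ℂPⁿ⁻¹ | z ∈ ℓ, |z| < ρ}` along `(z, ℓ) ∼ ι(z)`, `z ≠ 0`, has exactly one point for
each point of this set.  The topology and the smooth structure are given further below. -/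
inductive BlowUp (ι : BallEmbedding n X)
  | away (x : X) (hx : x ≠ ι.center)
  | line (ℓ : Projectivization ℂ (Cn n))

namespace BlowUp

variable (ι : BallEmbedding n X)

/-- The blow up map `π`. -/
def proj : BlowUp ι → X
  | away x _ => x
  | line _ => ι.center

/-- The exceptional divisor `E = π⁻¹(x₀)`. -/
def exceptional : Set (BlowUp ι) := proj ι ⁻¹' {ι.center}

/-- The inclusion of `{(z, ℓ) | z ∈ ℓ, |z| < ρ}` into the blow up (arbitrary on other pairs). -/
def ofModel (z : Cn n) (ℓ : Projectivization ℂ (Cn n)) : BlowUp ι :=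
  open Classical in
  if h : z ≠ 0 ∧ ‖z‖ < ι.radius then away (ι.map z) (ι.map_ne_center h) else line ℓ

theorem ofModel_of_ne {z : Cn n} (h : z ≠ 0 ∧ ‖z‖ < ι.radius) (ℓ : Projectivization ℂ (Cn n)) :
    ofModel ι z ℓ = away (ι.map z) (ι.map_ne_center h) := dif_pos h

theorem ofModel_of_eq {z : Cn n} (h : z = 0) (ℓ : Projectivization ℂ (Cn n)) :
    ofModel ι z ℓ = line ℓ := dif_neg fun h' ↦ h'.1 h

/-- The vector with `i`-th entry `1` and all other entries those of `y`. -/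
def dir (i : Fin n) (y : Cn n) : Cn n := WithLp.toLp 2 (fun k ↦ if k = i then 1 else y k)

theorem dir_self (i : Fin n) (y : Cn n) : dir i y i = 1 := by simp [dir]

theorem dir_ne_zero (i : Fin n) (y : Cn n) : dir i y ≠ 0 := fun h ↦ by
  have := dir_self i y
  rw [h] at this
  simp at this

/-- The blow down map of `ℂⁿ` in the `i`-th affine chart. -/
def down (i : Fin n) (y : Cn n) : Cn n := y i • dir i y

/-- The `i`-th affine coordinates of the pair `(z, ℂ w)`, defined where `w i ≠ 0`: the `i`-th
coordinate is `z i`, the other coordinates are `w k / w i`. -/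
def coord (i : Fin n) (z w : Cn n) : Cn n :=
  WithLp.toLp 2 (fun k ↦ if k = i then z i else w k / w i)

theorem down_self (i : Fin n) (y : Cn n) : down i y i = y i := by simp [down, dir]

theorem down_eq_zero {i : Fin n} {y : Cn n} : down i y = 0 ↔ y i = 0 := by
  simp [down, dir_ne_zero]

theorem coord_smul (i : Fin n) (z w : Cn n) {c : ℂ} (hc : c ≠ 0) :
    coord i z (c • w) = coord i z w := by
  ext k
  simp [coord, mul_div_mul_left _ _ hc]

theorem coord_down (i : Fin n) (y : Cn n) : coord i (down i y) (dir i y) = y := by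
  ext k
  by_cases hk : k = i
  · subst hk; simp [coord, down_self]
  · simp [coord, dir, hk]

theorem down_coord {i : Fin n} {z : Cn n} (hz : z i ≠ 0) : down i (coord i z z) = z := by
  ext k
  by_cases hk : k = i
  · subst hk; simp [coord, down_self]
  · simp [coord, down, dir, hk, mul_div_cancel₀ _ hz]

theorem rep_mk (w : Cn n) (hw : w ≠ 0) :
    ∃ c : ℂ, c ≠ 0 ∧ (Projectivization.mk ℂ w hw).rep = c • w := by
  obtain ⟨a, ha⟩ := Projectivization.exists_smul_eq_mk_rep ℂ w hw
  exact ⟨a, a.ne_zero, ha.symm⟩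

/-- The map of `chartAway`. -/
def awayFun (e : OpenPartialHomeomorph X (Cn n)) : BlowUp ι → Cn n
  | away x _ => e x
  | line _ => 0

/-- The inverse map of `chartAway`. -/
def awayInv (p₀ : BlowUp ι) (e : OpenPartialHomeomorph X (Cn n)) (y : Cn n) : BlowUp ι :=
  open Classical in if h : e.symm y ≠ ι.center then away (e.symm y) h else p₀

theorem awayInv_of_ne (p₀ : BlowUp ι) {e : OpenPartialHomeomorph X (Cn n)} {y : Cn n}
    (h : e.symm y ≠ ι.center) : awayInv ι p₀ e y = away (e.symm y) h := dif_pos h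

/-- The chart of the blow up that a chart `e` of `X` induces away from the exceptional divisor.
(The point `p₀` only serves as the irrelevant value of the inverse map outside of its domain.) -/
def chartAway (p₀ : BlowUp ι) (e : OpenPartialHomeomorph X (Cn n)) :
    PartialEquiv (BlowUp ι) (Cn n) where
  toFun := awayFun ι e
  invFun := awayInv ι p₀ e
  source := {p | p ∉ exceptional ι ∧ proj ι p ∈ e.source}
  target := {y | y ∈ e.target ∧ e.symm y ≠ ι.center}
  map_source' := by
    rintro (⟨x, hx⟩ | ℓ) ⟨h, he⟩
    · have he : x ∈ e.source := he
      simpa [awayFun, e.map_source he, e.left_inv he] using hx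
    · exact (h rfl).elim
  map_target' := by
    rintro y ⟨hy, hne⟩
    simpa [awayInv_of_ne ι p₀ hne, hne, exceptional, proj] using e.map_target hy
  left_inv' := by
    rintro (⟨x, hx⟩ | ℓ) ⟨h, he⟩
    · have he : x ∈ e.source := he
      simp [awayFun, awayInv, e.left_inv he, hx]
    · exact (h rfl).elim
  right_inv' := by
    rintro y ⟨hy, hne⟩
    simp [awayInv_of_ne ι p₀ hne, awayFun, e.right_inv hy]

/-- The map of `chartNear`. -/
def nearFun (i : Fin n) : BlowUp ι → Cn n
  | away x _ => coord i (ι.map.symm x) (ι.map.symm x)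
  | line ℓ => coord i 0 ℓ.rep

/-- The `i`-th affine chart around the exceptional divisor: on the image of
`{(z, ℓ) | z ∈ ℓ, |z| < ρ, ℓᵢ ≠ 0}` it is `(z, ℓ) ↦ (zᵢ; ℓₖ / ℓᵢ for k ≠ i)`. -/
def chartNear (i : Fin n) : PartialEquiv (BlowUp ι) (Cn n) where
  toFun := nearFun ι i
  invFun y := ofModel ι (down i y) (Projectivization.mk ℂ (dir i y) (dir_ne_zero i y))
  source := {p | (∃ (z : Cn n) (h : z ≠ 0 ∧ ‖z‖ < ι.radius), z i ≠ 0 ∧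
      p = away (ι.map z) (ι.map_ne_center h)) ∨ ∃ ℓ, ℓ.rep i ≠ 0 ∧ p = line ℓ}
  target := {y | ‖down i y‖ < ι.radius}
  map_source' := by
    rintro _ (⟨z, h, hz, rfl⟩ | ⟨ℓ, hℓ, rfl⟩)
    · simpa [nearFun, ι.map.left_inv (ι.mem_source h.2), down_coord hz] using h.2
    · have : down i (coord i 0 ℓ.rep) = 0 := by simp [down_eq_zero, coord]
      simpa [nearFun, this] using ι.radius_pos
  map_target' := by
    intro y hy
    by_cases h0 : y i = 0
    · right
      refine ⟨Projectivization.mk ℂ (dir i y) (dir_ne_zero i y), ?_,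
        ofModel_of_eq ι (down_eq_zero.2 h0) _⟩
      obtain ⟨c, hc, h⟩ := rep_mk (dir i y) (dir_ne_zero i y)
      simp [h, dir_self, hc]
    · left
      have h : down i y ≠ 0 ∧ ‖down i y‖ < ι.radius := ⟨by simpa [down_eq_zero] using h0, hy⟩
      exact ⟨down i y, h, by simpa [down_self] using h0, ofModel_of_ne ι h _⟩
  left_inv' := by
    rintro _ (⟨z, h, hz, rfl⟩ | ⟨ℓ, hℓ, rfl⟩)
    · simp [nearFun, ι.map.left_inv (ι.mem_source h.2), down_coord hz, ofModel_of_ne ι h]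
    · have h1 : dir i (coord i 0 ℓ.rep) = (ℓ.rep i)⁻¹ • ℓ.rep := by
        ext k
        by_cases hk : k = i
        · subst hk; simp [dir, hℓ]
        · simp [dir, coord, hk, div_eq_inv_mul]
      refine (ofModel_of_eq ι (by simp [nearFun, down_eq_zero, coord]) _).trans ?_
      congr 1
      conv_rhs => rw [← ℓ.mk_rep]
      rw [Projectivization.mk_eq_mk_iff']
      exact ⟨(ℓ.rep i)⁻¹, h1.symm⟩
  right_inv' := by
    intro y hy
    by_cases h0 : y i = 0
    · have h1 : down i y = 0 := down_eq_zero.2 h0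
      obtain ⟨c, hc, h⟩ := rep_mk (dir i y) (dir_ne_zero i y)
      rw [ofModel_of_eq ι h1, nearFun, h, coord_smul _ _ _ hc, ← h1, coord_down]
    · have h : down i y ≠ 0 ∧ ‖down i y‖ < ι.radius := ⟨by simpa [down_eq_zero] using h0, hy⟩
      rw [ofModel_of_ne ι h, nearFun, ι.map.left_inv (ι.mem_source h.2)]
      conv_lhs => rw [show coord i (down i y) (down i y) = coord i (down i y) (y i • dir i y)
        from rfl, coord_smul _ _ _ h0]
      exact coord_down i y

/-- The charts that define the topology and the smooth structure of the blow up. -/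
def charts : Set (PartialEquiv (BlowUp ι) (Cn n)) :=
  {c | (∃ p₀, ∃ e ∈ atlas (Cn n) X, c = chartAway ι p₀ e) ∨ ∃ i, c = chartNear ι i}

theorem exists_rep_ne_zero (ℓ : Projectivization ℂ (Cn n)) : ∃ i, ℓ.rep i ≠ 0 := by
  by_contra! h
  exact ℓ.rep_nonzero (by ext k; simpa using h k)

theorem exists_chart (p : BlowUp ι) : ∃ c ∈ charts ι, p ∈ c.source := by
  rcases p with ⟨x, hx⟩ | ℓ
  · exact ⟨chartAway ι (away x hx) (chartAt (Cn n) x), Or.inl ⟨_, _, chart_mem_atlas _ _, rfl⟩, hx,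
      mem_chart_source _ x⟩
  · obtain ⟨i, hi⟩ := exists_rep_ne_zero ℓ
    exact ⟨chartNear ι i, Or.inr ⟨i, rfl⟩, Or.inr ⟨ℓ, hi, rfl⟩⟩

theorem contDiff_apply_real (k : Fin n) : ContDiff ℝ ∞ (fun y : Cn n ↦ y k) :=
  (contDiff_piLp 2).1 contDiff_id k

theorem contDiff_dir (i : Fin n) : ContDiff ℝ ∞ (dir i : Cn n → Cn n) := by
  rw [contDiff_piLp 2]
  intro k
  by_cases hk : k = i
  · simpa [dir, hk] using contDiff_const
  · simpa only [dir, hk, if_false] using contDiff_apply_real k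

theorem contDiff_down (i : Fin n) : ContDiff ℝ ∞ (down i : Cn n → Cn n) :=
  (contDiff_apply_real i).smul (contDiff_dir i)

theorem contDiffOn_coord (i : Fin n) {S : Set (Cn n)} {f g : Cn n → Cn n}
    (hf : ContDiffOn ℝ ∞ f S) (hg : ContDiffOn ℝ ∞ g S) (h0 : ∀ y ∈ S, g y i ≠ 0) :
    ContDiffOn ℝ ∞ (fun y ↦ coord i (f y) (g y)) S := by
  rw [contDiffOn_piLp 2] at hf hg ⊢
  intro k
  by_cases hk : k = i
  · simpa [coord, hk] using hf i
  · simpa [coord, hk, div_eq_mul_inv] using (hg k).mul ((hg i).inv h0)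

theorem nearFun_ofModel (i j : Fin n) (y : Cn n) (hy : ‖down i y‖ < ι.radius) :
    nearFun ι j (ofModel ι (down i y) (Projectivization.mk ℂ (dir i y) (dir_ne_zero i y))) =
      coord j (down i y) (dir i y) := by
  by_cases h0 : y i = 0
  · have h1 : down i y = 0 := down_eq_zero.2 h0
    obtain ⟨c, hc, h⟩ := rep_mk (dir i y) (dir_ne_zero i y)
    rw [ofModel_of_eq ι h1, nearFun, h, coord_smul _ _ _ hc, h1]
  · rw [ofModel_of_ne ι ⟨by simpa [down_eq_zero] using h0, hy⟩, nearFun,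
      ι.map.left_inv (ι.mem_source hy)]
    exact coord_smul _ _ _ h0

theorem transition_near_near (i j : Fin n) :
    IsOpen ((chartNear ι i).symm.trans (chartNear ι j)).source ∧
    ContDiffOn ℝ ∞ ((chartNear ι i).symm.trans (chartNear ι j))
      ((chartNear ι i).symm.trans (chartNear ι j)).source := by
  have hS : ((chartNear ι i).symm.trans (chartNear ι j)).source =
      {y : Cn n | ‖down i y‖ < ι.radius ∧ dir i y j ≠ 0} := by
    ext y
    constructor
    · rintro ⟨hy, h⟩
      have hy : ‖down i y‖ < ι.radius := hy
      have h : ofModel ι (down i y) _ ∈ (chartNear ι j).source := h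
      refine ⟨hy, ?_⟩
      by_cases h0 : down i y = 0
      · rw [ofModel_of_eq ι h0] at h
        obtain ⟨z, hz, hzi, h⟩ | ⟨ℓ, hℓ, h⟩ := h
        · cases h
        · injection h with h
          obtain ⟨c, hc, h'⟩ := rep_mk (dir i y) (dir_ne_zero i y)
          rw [← h, h'] at hℓ
          exact fun h3 ↦ hℓ (by simp [h3])
      · rw [ofModel_of_ne ι ⟨h0, hy⟩] at h
        obtain ⟨z, hz, hzi, h⟩ | ⟨ℓ, hℓ, h⟩ := h
        · have h : ι.map (down i y) = ι.map z := by injection h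
          have := ι.map.injOn (ι.mem_source hy) (ι.mem_source hz.2) h
          rw [← this] at hzi
          exact fun h3 ↦ hzi (by simp [down, h3])
        · cases h
    · rintro ⟨hy, hj⟩
      refine ⟨hy, ?_⟩
      change ofModel ι (down i y) _ ∈ (chartNear ι j).source
      by_cases h0 : down i y = 0
      · rw [ofModel_of_eq ι h0]
        obtain ⟨c, hc, h'⟩ := rep_mk (dir i y) (dir_ne_zero i y)
        exact Or.inr ⟨_, by simp [h', hc, hj], rfl⟩
      · rw [ofModel_of_ne ι ⟨h0, hy⟩]
        refine Or.inl ⟨_, ⟨h0, hy⟩, ?_, rfl⟩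
        have : y i ≠ 0 := fun h ↦ h0 (down_eq_zero.2 h)
        simp [down, this, hj]
  rw [hS]
  constructor
  · have h1 : Continuous fun y : Cn n ↦ dir i y j :=
      ((contDiff_apply_real j).comp (contDiff_dir i)).continuous
    exact (isOpen_lt (contDiff_down i).continuous.norm continuous_const).inter
      (isOpen_ne_fun h1 continuous_const)
  · exact (contDiffOn_coord j (contDiff_down i).contDiffOn (contDiff_dir i).contDiffOn
      fun y hy ↦ hy.2).congr fun y hy ↦ nearFun_ofModel ι i j y hy.1

variable [IsManifold 𝓘(ℝ, Cn n) ∞ X]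

theorem contDiffOn_symm_symm {e : OpenPartialHomeomorph X (Cn n)} (he : e ∈ atlas (Cn n) X) :
    ContDiffOn ℝ ∞ (fun y ↦ ι.map.symm (e.symm y)) (e.target ∩ e.symm ⁻¹' ι.map.target) := by
  rw [← contMDiffOn_iff_contDiffOn]
  exact ι.smooth_symm.comp ((contMDiffOn_symm_of_mem_maximalAtlas
    (IsManifold.subset_maximalAtlas he)).mono inter_subset_left) fun y hy ↦ hy.2

theorem contDiffOn_map {e : OpenPartialHomeomorph X (Cn n)} (he : e ∈ atlas (Cn n) X) :
    ContDiffOn ℝ ∞ (fun z ↦ e (ι.map z)) (ι.map.source ∩ ι.map ⁻¹' e.source) := by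
  rw [← contMDiffOn_iff_contDiffOn]
  exact (contMDiffOn_of_mem_maximalAtlas (IsManifold.subset_maximalAtlas he)).comp
    (ι.smooth.mono inter_subset_left) fun y hy ↦ hy.2

theorem transition_away_away [T2Space X] (p₀ p₁ : BlowUp ι) {e e' : OpenPartialHomeomorph X (Cn n)}
    (he : e ∈ atlas (Cn n) X) (he' : e' ∈ atlas (Cn n) X) :
    IsOpen ((chartAway ι p₀ e).symm.trans (chartAway ι p₁ e')).source ∧
    ContDiffOn ℝ ∞ ((chartAway ι p₀ e).symm.trans (chartAway ι p₁ e'))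
      ((chartAway ι p₀ e).symm.trans (chartAway ι p₁ e')).source := by
  have hS : ((chartAway ι p₀ e).symm.trans (chartAway ι p₁ e')).source =
      e.target ∩ e.symm ⁻¹' (e'.source ∩ {ι.center}ᶜ) := by
    ext y
    constructor
    · rintro ⟨⟨hy, hne⟩, -, h⟩
      have h : proj ι (awayInv ι p₀ e y) ∈ e'.source := h
      rw [awayInv_of_ne ι p₀ hne] at h
      exact ⟨hy, h, hne⟩
    · rintro ⟨hy, h, hne⟩
      have hne : e.symm y ≠ ι.center := hne
      refine ⟨⟨hy, hne⟩, ?_⟩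
      change awayInv ι p₀ e y ∈ (chartAway ι p₁ e').source
      rw [awayInv_of_ne ι p₀ hne]
      exact ⟨hne, h⟩
  rw [hS]
  refine ⟨e.symm.isOpen_inter_preimage (e'.open_source.inter isOpen_compl_singleton), ?_⟩
  have h1 : ContDiffOn ℝ ∞ (fun y ↦ e' (e.symm y)) (e.target ∩ e.symm ⁻¹' e'.source) := by
    rw [← contMDiffOn_iff_contDiffOn]
    exact (contMDiffOn_of_mem_maximalAtlas (IsManifold.subset_maximalAtlas he')).comp
      ((contMDiffOn_symm_of_mem_maximalAtlas (IsManifold.subset_maximalAtlas he)).mono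
        inter_subset_left) fun y hy ↦ hy.2
  refine (h1.mono fun y hy ↦ ⟨hy.1, hy.2.1⟩).congr ?_
  rintro y ⟨hy, h, hne⟩
  have hne : e.symm y ≠ ι.center := hne
  change awayFun ι e' (awayInv ι p₀ e y) = _
  rw [awayInv_of_ne ι p₀ hne]
  rfl

theorem transition_away_near (p₀ : BlowUp ι) {e : OpenPartialHomeomorph X (Cn n)}
    (he : e ∈ atlas (Cn n) X) (i : Fin n) :
    IsOpen ((chartAway ι p₀ e).symm.trans (chartNear ι i)).source ∧
    ContDiffOn ℝ ∞ ((chartAway ι p₀ e).symm.trans (chartNear ι i))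
      ((chartAway ι p₀ e).symm.trans (chartNear ι i)).source := by
  have hS : ((chartAway ι p₀ e).symm.trans (chartNear ι i)).source =
      e.target ∩ e.symm ⁻¹' (ι.map.target ∩ ι.map.symm ⁻¹'
        {z : Cn n | z i ≠ 0 ∧ ‖z‖ < ι.radius}) := by
    ext y
    constructor
    · rintro ⟨⟨hy, hne⟩, h⟩
      have h : awayInv ι p₀ e y ∈ (chartNear ι i).source := h
      rw [awayInv_of_ne ι p₀ hne] at h
      obtain ⟨z, hz, hzi, h⟩ | ⟨ℓ, -, h⟩ := h
      · have h : e.symm y = ι.map z := by injection h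
        refine ⟨hy, ?_⟩
        simp only [mem_preimage, h]
        exact ⟨ι.map.map_source (ι.mem_source hz.2), by
          simpa [ι.map.left_inv (ι.mem_source hz.2), hzi] using hz.2⟩
      · cases h
    · rintro ⟨hy, ht, hzi, hz⟩
      have h0 : ι.map.symm (e.symm y) ≠ 0 := fun h ↦ hzi (by simp [h])
      have hr := ι.map.right_inv ht
      have hne : e.symm y ≠ ι.center := by
        rw [← hr]; exact ι.map_ne_center ⟨h0, hz⟩
      refine ⟨⟨hy, hne⟩, ?_⟩
      change awayInv ι p₀ e y ∈ (chartNear ι i).source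
      rw [awayInv_of_ne ι p₀ hne]
      refine Or.inl ⟨_, ⟨h0, hz⟩, hzi, ?_⟩
      congr 1
      exact hr.symm
  rw [hS]
  constructor
  · refine e.symm.isOpen_inter_preimage (ι.map.symm.isOpen_inter_preimage ?_)
    have h1 : Continuous fun z : Cn n ↦ z i := by fun_prop
    exact (isOpen_ne_fun h1 continuous_const).inter (isOpen_lt continuous_norm continuous_const)
  · have h1 := (contDiffOn_symm_symm ι he).mono (t := e.target ∩ e.symm ⁻¹' (ι.map.target ∩
      ι.map.symm ⁻¹' {z : Cn n | z i ≠ 0 ∧ ‖z‖ < ι.radius})) fun y hy ↦ ⟨hy.1, hy.2.1⟩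
    refine (contDiffOn_coord i h1 h1 fun y hy ↦ hy.2.2.1).congr ?_
    rintro y ⟨hy, ht, hzi, hz⟩
    have hne : e.symm y ≠ ι.center := by
      rw [← ι.map.right_inv ht]
      exact ι.map_ne_center ⟨fun h ↦ hzi (by simp [h]), hz⟩
    change nearFun ι i (awayInv ι p₀ e y) = _
    rw [awayInv_of_ne ι p₀ hne]
    rfl

theorem transition_near_away (p₀ : BlowUp ι) {e : OpenPartialHomeomorph X (Cn n)}
    (he : e ∈ atlas (Cn n) X) (i : Fin n) :
    IsOpen ((chartNear ι i).symm.trans (chartAway ι p₀ e)).source ∧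
    ContDiffOn ℝ ∞ ((chartNear ι i).symm.trans (chartAway ι p₀ e))
      ((chartNear ι i).symm.trans (chartAway ι p₀ e)).source := by
  have hS : ((chartNear ι i).symm.trans (chartAway ι p₀ e)).source =
      down i ⁻¹' ({z : Cn n | z ≠ 0 ∧ ‖z‖ < ι.radius} ∩ (ι.map.source ∩ ι.map ⁻¹' e.source)) := by
    ext y
    constructor
    · rintro ⟨hy, hE, h⟩
      have hy : ‖down i y‖ < ι.radius := hy
      have hE : ofModel ι _ _ ∉ exceptional ι := hE
      have h : proj ι (ofModel ι _ _) ∈ e.source := h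
      by_cases h0 : down i y = 0
      · rw [ofModel_of_eq ι h0] at hE
        exact (hE rfl).elim
      · rw [ofModel_of_ne ι ⟨h0, hy⟩] at h
        exact ⟨⟨h0, hy⟩, ι.mem_source hy, h⟩
    · rintro ⟨hy, -, h⟩
      refine ⟨hy.2, ?_⟩
      change ofModel ι _ _ ∈ (chartAway ι p₀ e).source
      rw [ofModel_of_ne ι hy]
      exact ⟨ι.map_ne_center hy, h⟩
  rw [hS]
  constructor
  · refine IsOpen.preimage (contDiff_down i).continuous (IsOpen.inter ?_
      (ι.map.isOpen_inter_preimage e.open_source))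
    exact (isOpen_ne_fun continuous_id continuous_const).inter
      (isOpen_lt continuous_norm continuous_const)
  · refine ((contDiffOn_map ι he).comp (contDiff_down i).contDiffOn fun y hy ↦ hy.2).congr ?_
    rintro y ⟨hy, -, h⟩
    change awayFun ι e (ofModel ι _ _) = _
    rw [ofModel_of_ne ι hy]
    rfl

theorem transition [T2Space X] {c c' : PartialEquiv (BlowUp ι) (Cn n)} (hc : c ∈ charts ι)
    (hc' : c' ∈ charts ι) :
    IsOpen (c.symm.trans c').source ∧
      ContDiffOn ℝ ∞ (c.symm.trans c') (c.symm.trans c').source := by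
  obtain ⟨p₀, e, he, rfl⟩ | ⟨i, rfl⟩ := hc <;> obtain ⟨p₁, e', he', rfl⟩ | ⟨j, rfl⟩ := hc'
  · exact transition_away_away ι p₀ p₁ he he'
  · exact transition_away_near ι p₀ he j
  · exact transition_near_away ι p₁ he' i
  · exact transition_near_near ι i j

/-- The smooth atlas of the blow up (which also determines its topology). -/
def core [T2Space X] : ChartedSpaceCore (Cn n) (BlowUp ι) where
  atlas := charts ι
  chartAt p := (exists_chart ι p).choose
  mem_chart_source p := (exists_chart ι p).choose_spec.2
  chart_mem_atlas p := (exists_chart ι p).choose_spec.1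
  open_source _ _ hc hc' := (transition ι hc hc').1
  continuousOn_toFun _ _ hc hc' := (transition ι hc hc').2.continuousOn

instance [T2Space X] : TopologicalSpace (BlowUp ι) := (core ι).toTopologicalSpace

instance [T2Space X] : ChartedSpace (Cn n) (BlowUp ι) := (core ι).toChartedSpace

instance [T2Space X] : IsManifold 𝓘(ℝ, Cn n) ∞ (BlowUp ι) := by
  apply isManifold_of_contDiffOn
  intro e e' he he'
  obtain ⟨c, hc, rfl⟩ : ∃ c, ∃ hc : c ∈ charts ι, e = (core ι).openPartialHomeomorph c hc := by
    have := he
    simp only [atlas, ChartedSpace.atlas, mem_iUnion, mem_singleton_iff] at this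
    exact this
  obtain ⟨c', hc', rfl⟩ : ∃ c, ∃ hc : c ∈ charts ι, e' = (core ι).openPartialHomeomorph c hc := by
    have := he'
    simp only [atlas, ChartedSpace.atlas, mem_iUnion, mem_singleton_iff] at this
    exact this
  have h := (transition ι hc hc').2
  simp only [modelWithCornersSelf_coe, modelWithCornersSelf_coe_symm, Function.id_comp,
    Function.comp_id, range_id, inter_univ, preimage_id]
  exact h

end BlowUp
end Points

/-! ### Multiplicity -/

/-- A disk `u` has multiplicity `k` at the base point `x₀ = ι(0)`: it meets `x₀` in finitely many
points `z`, and the orders of vanishing at these points of the `ℂⁿ`-valued function `ι⁻¹ ∘ u` (the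
largest power of `w - z` that divides it) add up to `k`. -/
def HasMultiplicity {n : ℕ} {X : Type*} [TopologicalSpace X] [ChartedSpace (Cn n) X]
    (ι : BallEmbedding n X) (u : ℂ → X) (k : ℕ∞) : Prop :=
  ∃ S : Finset ℂ, (∀ z, z ∈ S ↔ z ∈ unitDisk ∧ u z = ι.center) ∧
    ∑ z ∈ S, analyticOrderAt (fun w ↦ ι.map.symm (u w)) z = k

end BlowUp

/-! Away from `E` the map `π` is a local diffeomorphism, so the structure on the blow up is forced
there: it is the pullback of `J`. Around `E`, `π` reads `ι ∘ down i` in the `i`-th affine chart.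
Since `down i` is holomorphic and `ι` carries `i` to `J`, multiplication by `i` in that chart is
also intertwined with `J`. The affine charts have holomorphic transitions, so these local structures
fit together, and their coordinate expressions show smoothness. Uniqueness extends from the
complement of `E` by density and continuity (`dnear_structureFun`, `eq_almostComplexStructure`).

For a disk `u`, the map `ι⁻¹ ∘ u` is holomorphic near each preimage of `x₀`, and these preimages are
interior because `x₀ ∉ L`. It cannot vanish identically near a point: by the identity theorem `u`
would equal `x₀` on the open disk, hence also at a boundary point. So preimages are isolated with
finite order, and compactness leaves finitely many. Write `ι⁻¹(u w) = (w - z)^k h(w)` with `h z ≠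
0`. For `w ≠ z` the line through this vector is also spanned by `h w`, which has a limit at `z`.
This gives both a holomorphic formula for the lift in an affine chart
(`eventually_eq_nearChart_symm`) and the only possible value over `x₀` of a continuous lift
(`eq_line_of_lift`).

In an affine chart `E` is `{y i = 0}`, and along the lift `y i = (w - z)^k h_i(w)` with `h_i(z) ≠
0`, which winds `k` times. An arbitrary oriented defining function need not be holomorphic. Its
derivative transverse to `E` has the form `c ↦ a c + b c̄`, and the orientation condition says
exactly `‖b‖ < ‖a‖`. Hence its quotient by `a (y i)` has positive real part near the point, off `E`,
and does not affect the winding number (`eventually_pos_re_of_zero_on_hyperplane`,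
`eventually_hasWindingNumber`). Summing over the preimages gives the multiplicity. -/

/-! ### Derivatives of maps of manifolds as maps of the model spaces -/

section ModelDerivative

variable {E E' E'' : Type*} [NormedAddCommGroup E] [NormedSpace ℝ E]
  [NormedAddCommGroup E'] [NormedSpace ℝ E'] [NormedAddCommGroup E''] [NormedSpace ℝ E'']
  {X : Type*} [TopologicalSpace X] [ChartedSpace E X]
  {Y : Type*} [TopologicalSpace Y] [ChartedSpace E' Y]
  {Z : Type*} [TopologicalSpace Z] [ChartedSpace E'' Z]

/-- The derivative of a map of manifolds, as a linear map of the model spaces (which the tangent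
spaces are by definition). -/
noncomputable def modelDeriv (f : X → Y) (x : X) : E →L[ℝ] E' :=
  mfderiv 𝓘(ℝ, E) 𝓘(ℝ, E') f x

theorem modelDeriv_comp {g : Y → Z} {f : X → Y} (x : X)
    (hg : MDifferentiableAt 𝓘(ℝ, E') 𝓘(ℝ, E'') g (f x))
    (hf : MDifferentiableAt 𝓘(ℝ, E) 𝓘(ℝ, E') f x) :
    modelDeriv (E := E) (E' := E'') (fun x ↦ g (f x)) x =
      (modelDeriv (E := E') (E' := E'') g (f x)) ∘L (modelDeriv (E := E) (E' := E') f x) :=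
  mfderiv_comp x hg hf

theorem modelDeriv_eq_fderiv (f : E → E') (x : E) :
    modelDeriv (E := E) (E' := E') f x = fderiv ℝ f x :=
  mfderiv_eq_fderiv

theorem Filter.EventuallyEq.modelDeriv_eq {f g : X → Y} {x : X} (h : f =ᶠ[𝓝 x] g) :
    modelDeriv (E := E) (E' := E') f x = modelDeriv (E := E) (E' := E') g x :=
  h.mfderiv_eq

theorem modelDeriv_id (x : X) :
    modelDeriv (E := E) (E' := E) (fun x : X ↦ x) x = ContinuousLinearMap.id ℝ E :=
  mfderiv_id

end ModelDerivative

/-! ### Smoothness of endomorphism fields in charts -/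

section ChartRep

variable {n : ℕ} {X : Type*} [TopologicalSpace X] [ChartedSpace (Cn n) X]

theorem mdifferentiable_of_mem_maximalAtlas {e : OpenPartialHomeomorph X (Cn n)}
    (he : e ∈ IsManifold.maximalAtlas 𝓘(ℝ, Cn n) ∞ X) :
    e.MDifferentiable 𝓘(ℝ, Cn n) 𝓘(ℝ, Cn n) :=
  ⟨(contMDiffOn_of_mem_maximalAtlas he).mdifferentiableOn (by simp),
    (contMDiffOn_symm_of_mem_maximalAtlas he).mdifferentiableOn (by simp)⟩

theorem OpenPartialHomeomorph.MDifferentiable.modelDeriv_symm_apply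
    {Y : Type*} [TopologicalSpace Y] [ChartedSpace (Cn n) Y] {e : OpenPartialHomeomorph X Y}
    (he : e.MDifferentiable 𝓘(ℝ, Cn n) 𝓘(ℝ, Cn n)) {x : X} (hx : x ∈ e.source) (v : Cn n) :
    modelDeriv (E := Cn n) (E' := Cn n) e.symm (e x)
      (modelDeriv (E := Cn n) (E' := Cn n) e x v) = v :=
  DFunLike.congr_fun (he.symm_comp_deriv hx) v

theorem OpenPartialHomeomorph.MDifferentiable.modelDeriv_apply_symm
    {Y : Type*} [TopologicalSpace Y] [ChartedSpace (Cn n) Y] {e : OpenPartialHomeomorph X Y}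
    (he : e.MDifferentiable 𝓘(ℝ, Cn n) 𝓘(ℝ, Cn n)) {y : Y} (hy : y ∈ e.target) (v : Cn n) :
    modelDeriv (E := Cn n) (E' := Cn n) e (e.symm y)
      (modelDeriv (E := Cn n) (E' := Cn n) e.symm y v) = v :=
  DFunLike.congr_fun (he.comp_symm_deriv hy) v

/-- The expression in the chart `e` of a field `T` of endomorphisms of the tangent spaces. -/
noncomputable def chartRep (e : OpenPartialHomeomorph X (Cn n))
    (T : X → Cn n →L[ℝ] Cn n) (y : Cn n) : Cn n →L[ℝ] Cn n :=
  (modelDeriv (E := Cn n) (E' := Cn n) e (e.symm y)) ∘L (T (e.symm y)) ∘L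
    (modelDeriv (E := Cn n) (E' := Cn n) e.symm y)

theorem contDiffAt_transition {e e' : OpenPartialHomeomorph X (Cn n)}
    (he : e ∈ IsManifold.maximalAtlas 𝓘(ℝ, Cn n) ∞ X)
    (he' : e' ∈ IsManifold.maximalAtlas 𝓘(ℝ, Cn n) ∞ X) {y : Cn n} (hy : y ∈ e.target)
    (hy' : e.symm y ∈ e'.source) : ContDiffAt ℝ ∞ (fun y ↦ e' (e.symm y)) y := by
  rw [← contMDiffAt_iff_contDiffAt]
  exact (contMDiffAt_of_mem_maximalAtlas he' hy').comp y
    (contMDiffAt_symm_of_mem_maximalAtlas he hy)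

theorem fderiv_transition {e e' : OpenPartialHomeomorph X (Cn n)}
    (he : e ∈ IsManifold.maximalAtlas 𝓘(ℝ, Cn n) ∞ X)
    (he' : e' ∈ IsManifold.maximalAtlas 𝓘(ℝ, Cn n) ∞ X) {y : Cn n} (hy : y ∈ e.target)
    (hy' : e.symm y ∈ e'.source) :
    fderiv ℝ (fun y ↦ e' (e.symm y)) y =
      (modelDeriv (E := Cn n) (E' := Cn n) e' (e.symm y)) ∘L
        (modelDeriv (E := Cn n) (E' := Cn n) e.symm y) := by
  rw [← modelDeriv_eq_fderiv]
  exact modelDeriv_comp y ((mdifferentiable_of_mem_maximalAtlas he').mdifferentiableAt hy')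
    ((mdifferentiable_of_mem_maximalAtlas he).mdifferentiableAt_symm hy)

theorem chartRep_transition {e e' : OpenPartialHomeomorph X (Cn n)}
    (he : e ∈ IsManifold.maximalAtlas 𝓘(ℝ, Cn n) ∞ X)
    (he' : e' ∈ IsManifold.maximalAtlas 𝓘(ℝ, Cn n) ∞ X) (T : X → Cn n →L[ℝ] Cn n)
    {y : Cn n} (hy : y ∈ e'.target) (hy' : e'.symm y ∈ e.source) :
    chartRep e' T y = (fderiv ℝ (fun y ↦ e' (e.symm y)) (e (e'.symm y))) ∘L
      (chartRep e T (e (e'.symm y))) ∘L (fderiv ℝ (fun y ↦ e (e'.symm y)) y) := by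
  rw [fderiv_transition he' he hy hy', fderiv_transition he he' (y := e (e'.symm y))
    (e.map_source hy') (by simpa [e.left_inv hy'] using e'.map_target hy)]
  ext1 v
  simp only [chartRep, ContinuousLinearMap.coe_comp, Function.comp_apply, e.left_inv hy',
    (mdifferentiable_of_mem_maximalAtlas he).modelDeriv_symm_apply hy']

/-- Changing charts conjugates the expression by the derivative of the transition map, which is
itself smooth. Smoothness may therefore be tested in any one chart of the maximal atlas. -/
theorem ContDiffAt.chartRep_of_chartRep {e e' : OpenPartialHomeomorph X (Cn n)}
    (he : e ∈ IsManifold.maximalAtlas 𝓘(ℝ, Cn n) ∞ X)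
    (he' : e' ∈ IsManifold.maximalAtlas 𝓘(ℝ, Cn n) ∞ X)
    {T : X → Cn n →L[ℝ] Cn n} {x : X}
    (hx : x ∈ e.source) (hx' : x ∈ e'.source) (h : ContDiffAt ℝ ∞ (chartRep e T) (e x)) :
    ContDiffAt ℝ ∞ (chartRep e' T) (e' x) := by
  have hev : ∀ᶠ y in 𝓝 (e' x), y ∈ e'.target ∩ e'.symm ⁻¹' e.source :=
    (e'.isOpen_inter_preimage_symm e.open_source).mem_nhds
      ⟨e'.map_source hx', by simpa [e'.left_inv hx'] using hx⟩
  have hyx : e'.symm (e' x) = x := e'.left_inv hx'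
  have h1 : ContDiffAt ℝ ∞ (fun y ↦ e (e'.symm y)) (e' x) :=
    contDiffAt_transition he' he (e'.map_source hx') (by rwa [hyx])
  have h2 : ContDiffAt ℝ ∞ (fun y ↦ e' (e.symm y)) (e x) :=
    contDiffAt_transition he he' (e.map_source hx) (by rwa [e.left_inv hx])
  have h3 : ContDiffAt ℝ ∞ (fderiv ℝ (fun y ↦ e' (e.symm y))) (e x) := h2.fderiv_right (by simp)
  have h4 : ContDiffAt ℝ ∞ (fderiv ℝ (fun y ↦ e (e'.symm y))) (e' x) := h1.fderiv_right (by simp)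
  have h5 : ContDiffAt ℝ ∞ (fun y ↦ chartRep e T (e (e'.symm y))) (e' x) :=
    ContDiffAt.comp (g := chartRep e T) (e' x) (by simpa [hyx] using h) h1
  have h6 : ContDiffAt ℝ ∞ (fun y ↦ fderiv ℝ (fun y ↦ e' (e.symm y)) (e (e'.symm y))) (e' x) :=
    ContDiffAt.comp (g := fderiv ℝ (fun y ↦ e' (e.symm y))) (e' x) (by simpa [hyx] using h3) h1
  refine (h6.clm_comp (h5.clm_comp h4)).congr_of_eventuallyEq ?_
  filter_upwards [hev] with y hy
  exact chartRep_transition he he' T hy.1 hy.2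

variable [IsManifold 𝓘(ℝ, Cn n) ∞ X]

/-- Replaces smoothness of a section of the endomorphism bundle by smoothness of a function with
values in a fixed vector space. The bundle trivialization at `x` is the expression in the preferred
chart at `x`; the preceding lemma passes to any other chart, which allows the affine charts of the
blow up. -/
theorem contMDiffAt_endomorphism_iff (T : X → Cn n →L[ℝ] Cn n)
    {e : OpenPartialHomeomorph X (Cn n)}
    (he : e ∈ IsManifold.maximalAtlas 𝓘(ℝ, Cn n) ∞ X) {x : X} (hx : x ∈ e.source) :
    ContMDiffAt 𝓘(ℝ, Cn n) (𝓘(ℝ, Cn n).prod 𝓘(ℝ, Cn n →L[ℝ] Cn n)) ∞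
      (fun x ↦ TotalSpace.mk' (Cn n →L[ℝ] Cn n)
        (E := fun y : X ↦ TangentSpace 𝓘(ℝ, Cn n) y →L[ℝ] TangentSpace 𝓘(ℝ, Cn n) y) x (T x)) x ↔
      ContDiffAt ℝ ∞ (chartRep e T) (e x) := by
  have hc := IsManifold.chart_mem_maximalAtlas (I := 𝓘(ℝ, Cn n)) (n := ∞) x
  have hxc := mem_chart_source (Cn n) x
  have key : (ContDiffAt ℝ ∞ (chartRep (chartAt (Cn n) x) T) (chartAt (Cn n) x x)) ↔
      ContDiffAt ℝ ∞ (chartRep e T) (e x) :=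
    ⟨fun h ↦ h.chartRep_of_chartRep hc he hxc hx, fun h ↦ h.chartRep_of_chartRep he hc hx hxc⟩
  rw [← key, contMDiffAt_hom_bundle]
  have h1 : (fun y : X ↦ ContinuousLinearMap.inCoordinates (Cn n) (TangentSpace 𝓘(ℝ, Cn n))
      (Cn n) (TangentSpace 𝓘(ℝ, Cn n)) x y x y (T y)) =ᶠ[𝓝 x]
      fun y ↦ chartRep (chartAt (Cn n) x) T (chartAt (Cn n) x y) := by
    filter_upwards [(chartAt (Cn n) x).open_source.mem_nhds hxc] with y hy
    have := inTangentCoordinates_eq_mfderiv_comp (I := 𝓘(ℝ, Cn n)) (I' := 𝓘(ℝ, Cn n))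
      (f := fun y : X ↦ y) (g := fun y : X ↦ y) (ϕ := T) (x₀ := x) (x := y) hy hy
    refine Eq.trans this ?_
    simp only [mfld_simps, mfderivWithin_univ]
    simp only [chartRep, (chartAt (Cn n) x).left_inv hy]
    rfl
  constructor
  · rintro ⟨-, h⟩
    have h := h.congr_of_eventuallyEq h1.symm
    rw [← contMDiffAt_iff_contDiffAt]
    have h2 : ContMDiffAt 𝓘(ℝ, Cn n) 𝓘(ℝ, Cn n →L[ℝ] Cn n) ∞ (fun z ↦
        chartRep (chartAt (Cn n) x) T (chartAt (Cn n) x ((chartAt (Cn n) x).symm z)))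
        (chartAt (Cn n) x x) := by
      refine ContMDiffAt.comp (chartAt (Cn n) x x) (g := fun y ↦
        chartRep (chartAt (Cn n) x) T (chartAt (Cn n) x y)) ?_
        (contMDiffAt_symm_of_mem_maximalAtlas hc (mem_chart_target _ x))
      rw [(chartAt (Cn n) x).left_inv hxc]
      exact h
    refine h2.congr_of_eventuallyEq ?_
    filter_upwards [(chartAt (Cn n) x).open_target.mem_nhds (mem_chart_target _ x)] with z hz
    rw [(chartAt (Cn n) x).right_inv hz]
  · intro h
    refine ⟨contMDiffAt_id, ContMDiffAt.congr_of_eventuallyEq ?_ h1⟩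
    rw [← contMDiffAt_iff_contDiffAt] at h
    exact h.comp x (contMDiffAt_of_mem_maximalAtlas hc hxc)

end ChartRep

/-! ### Almost complex structures on the model space -/

section Model

variable {n : ℕ} {X : Type*} [TopologicalSpace X] [ChartedSpace (Cn n) X]
  [IsManifold 𝓘(ℝ, Cn n) ∞ X]

/-- An almost complex structure as a family of endomorphisms of the model space. -/
def AlmostComplexStructure.model (J : AlmostComplexStructure n X) (x : X) : Cn n →L[ℝ] Cn n :=
  J.toFun x

theorem AlmostComplexStructure.model_sq (J : AlmostComplexStructure n X) (x : X) (v : Cn n) :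
    J.model x (J.model x v) = -v := J.sq x v

theorem AlmostComplexStructure.contDiffAt_chartRep (J : AlmostComplexStructure n X)
    {e : OpenPartialHomeomorph X (Cn n)}
    (he : e ∈ IsManifold.maximalAtlas 𝓘(ℝ, Cn n) ∞ X) {x : X} (hx : x ∈ e.source) :
    ContDiffAt ℝ ∞ (chartRep e J.model) (e x) :=
  (contMDiffAt_endomorphism_iff J.model he hx).1 (J.smooth x)

theorem BallEmbedding.PullsBackToStandard.model {ι : BallEmbedding n X}
    {J : AlmostComplexStructure n X}
    (h : ι.PullsBackToStandard J) {z : Cn n} (hz : ‖z‖ < ι.radius) (v : Cn n) :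
    modelDeriv (E := Cn n) (E' := Cn n) ι.map z (Complex.I • v) =
      J.model (ι.map z) (modelDeriv (E := Cn n) (E' := Cn n) ι.map z v) :=
  h z (by simpa using hz.le) v

end Model

theorem fderiv_real_I_smul {E F : Type*} [NormedAddCommGroup E] [NormedSpace ℂ E]
    [NormedAddCommGroup F] [NormedSpace ℂ F] {f : E → F} {x : E} (h : DifferentiableAt ℂ f x)
    (v : E) : fderiv ℝ f x (Complex.I • v) = Complex.I • fderiv ℝ f x v := by
  rw [h.fderiv_restrictScalars ℝ]
  simp

/-- The standard complex structure of `ℂⁿ`. -/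
noncomputable def mulI (n : ℕ) : Cn n →L[ℝ] Cn n := Complex.I • ContinuousLinearMap.id ℝ (Cn n)

/-- In an affine chart this is the complement of `E`; its density makes the structure on the blow up
unique along `E`. -/
theorem dense_apply_ne_zero {n : ℕ} (i : Fin n) : Dense {y : Cn n | y i ≠ 0} := by
  have h : IsOpenMap (EuclideanSpace.proj i : Cn n →L[ℂ] ℂ) :=
    (EuclideanSpace.proj i : Cn n →L[ℂ] ℂ).isOpenMap fun c ↦
      ⟨WithLp.toLp 2 (fun _ ↦ c), rfl⟩
  exact (dense_compl_singleton (0 : ℂ)).preimage h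

/-! ### The charts of the blow up and the derivative of `π` -/

noncomputable section BlowUpStructure

namespace BlowUp

variable {n : ℕ}

theorem differentiable_dir (i : Fin n) : Differentiable ℂ (dir i : Cn n → Cn n) := by
  rw [differentiable_piLp 2]
  intro k
  by_cases hk : k = i
  · simp [dir, hk]
  · simp only [dir, hk, if_false]
    exact (EuclideanSpace.proj k : Cn n →L[ℂ] ℂ).differentiable

theorem differentiable_down (i : Fin n) : Differentiable ℂ (down i : Cn n → Cn n) :=
  ((EuclideanSpace.proj i : Cn n →L[ℂ] ℂ).differentiable).smul (differentiable_dir i)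

theorem differentiableAt_coord {E : Type*} [NormedAddCommGroup E] [NormedSpace ℂ E] (i : Fin n)
    {f g : E → Cn n} {y : E} (hf : DifferentiableAt ℂ f y) (hg : DifferentiableAt ℂ g y)
    (h0 : g y i ≠ 0) : DifferentiableAt ℂ (fun y ↦ coord i (f y) (g y)) y := by
  rw [differentiableAt_piLp 2] at hf hg ⊢
  intro k
  by_cases hk : k = i
  · simpa [coord, hk] using hf i
  · simpa [coord, hk, div_eq_mul_inv] using (hg k).fun_mul ((hg i).fun_inv h0)

variable {X : Type*} [TopologicalSpace X] [ChartedSpace (Cn n) X] (ι : BallEmbedding n X)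

theorem proj_ofModel {z : Cn n} (hz : ‖z‖ < ι.radius) (ℓ : Projectivization ℂ (Cn n)) :
    proj ι (ofModel ι z ℓ) = ι.map z := by
  by_cases h : z = 0
  · subst h; rw [ofModel_of_eq ι rfl]; rfl
  · rw [ofModel_of_ne ι ⟨h, hz⟩]; rfl

/-- The inverse of `π` away from the base point (with an irrelevant value at the base point). -/
def lift (p₀ : BlowUp ι) (x : X) : BlowUp ι :=
  open Classical in if h : x ≠ ι.center then away x h else p₀

theorem lift_of_ne (p₀ : BlowUp ι) {x : X} (h : x ≠ ι.center) : lift ι p₀ x = away x h :=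
  dif_pos h

theorem proj_lift (p₀ : BlowUp ι) {x : X} (h : x ≠ ι.center) : proj ι (lift ι p₀ x) = x := by
  rw [lift_of_ne ι p₀ h]; rfl

theorem lift_proj (p₀ : BlowUp ι) {p : BlowUp ι} (h : proj ι p ≠ ι.center) :
    lift ι p₀ (proj ι p) = p := by
  rcases p with ⟨x, hx⟩ | ℓ
  · exact lift_of_ne ι p₀ hx
  · exact (h rfl).elim

variable [IsManifold 𝓘(ℝ, Cn n) ∞ X] [T2Space X]

/-- The chart `chartNear` as a partial homeomorphism. -/
def nearChart (i : Fin n) : OpenPartialHomeomorph (BlowUp ι) (Cn n) :=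
  (core ι).openPartialHomeomorph (chartNear ι i) (Or.inr ⟨i, rfl⟩)

/-- The chart `chartAway` as a partial homeomorphism. -/
def awayChart (p₀ : BlowUp ι) {e : OpenPartialHomeomorph X (Cn n)} (he : e ∈ atlas (Cn n) X) :
    OpenPartialHomeomorph (BlowUp ι) (Cn n) :=
  (core ι).openPartialHomeomorph (chartAway ι p₀ e) (Or.inl ⟨p₀, e, he, rfl⟩)

theorem nearChart_mem (i : Fin n) :
    nearChart ι i ∈ IsManifold.maximalAtlas 𝓘(ℝ, Cn n) ∞ (BlowUp ι) := by
  apply IsManifold.subset_maximalAtlas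
  simp only [atlas, ChartedSpace.atlas, mem_iUnion, mem_singleton_iff]
  exact ⟨chartNear ι i, Or.inr ⟨i, rfl⟩, rfl⟩

theorem awayChart_mem (p₀ : BlowUp ι) {e : OpenPartialHomeomorph X (Cn n)}
    (he : e ∈ atlas (Cn n) X) :
    awayChart ι p₀ he ∈ IsManifold.maximalAtlas 𝓘(ℝ, Cn n) ∞ (BlowUp ι) := by
  apply IsManifold.subset_maximalAtlas
  simp only [atlas, ChartedSpace.atlas, mem_iUnion, mem_singleton_iff]
  exact ⟨chartAway ι p₀ e, Or.inl ⟨p₀, e, he, rfl⟩, rfl⟩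

theorem mem_nearChart_target {i : Fin n} {y : Cn n} :
    y ∈ (nearChart ι i).target ↔ ‖down i y‖ < ι.radius := Iff.rfl

theorem line_mem_nearChart_source {i : Fin n} {ℓ : Projectivization ℂ (Cn n)} :
    (line ℓ : BlowUp ι) ∈ (nearChart ι i).source ↔ ℓ.rep i ≠ 0 := by
  constructor
  · rintro (⟨z, h, -, h'⟩ | ⟨ℓ', h, h'⟩)
    · cases h'
    · cases h'; exact h
  · exact fun h ↦ Or.inr ⟨ℓ, h, rfl⟩

theorem nearChart_symm_apply (i : Fin n) (y : Cn n) : (nearChart ι i).symm y =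
    ofModel ι (down i y) (Projectivization.mk ℂ (dir i y) (dir_ne_zero i y)) := rfl

theorem proj_nearChart_symm {i : Fin n} {y : Cn n} (hy : y ∈ (nearChart ι i).target) :
    proj ι ((nearChart ι i).symm y) = ι.map (down i y) := proj_ofModel ι hy _

theorem proj_eq_nearChart {i : Fin n} {p : BlowUp ι} (hp : p ∈ (nearChart ι i).source) :
    proj ι p = ι.map (down i (nearChart ι i p)) := by
  conv_lhs => rw [← (nearChart ι i).left_inv hp]
  exact proj_nearChart_symm ι ((nearChart ι i).map_source hp)

theorem awayChart_apply {p₀ : BlowUp ι} {e : OpenPartialHomeomorph X (Cn n)}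
    {he : e ∈ atlas (Cn n) X} {p : BlowUp ι} (hp : p ∈ (awayChart ι p₀ he).source) :
    awayChart ι p₀ he p = e (proj ι p) := by
  rcases p with ⟨x, hx⟩ | ℓ
  · rfl
  · exact (hp.1 rfl).elim

theorem awayChart_symm_apply {p₀ : BlowUp ι} {e : OpenPartialHomeomorph X (Cn n)}
    {he : e ∈ atlas (Cn n) X} (y : Cn n) :
    (awayChart ι p₀ he).symm y = lift ι p₀ (e.symm y) := rfl

/-- Near `E` the map is `ι ∘ down i` in an affine chart; elsewhere it is the identity in a chart
induced from `X`. -/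
theorem contMDiff_proj : ContMDiff 𝓘(ℝ, Cn n) 𝓘(ℝ, Cn n) ∞ (proj ι) := by
  intro p
  by_cases h : proj ι p = ι.center
  · rcases p with ⟨x, hx⟩ | ℓ
    · exact (hx h).elim
    obtain ⟨i, hi⟩ := exists_rep_ne_zero ℓ
    have hp := (line_mem_nearChart_source ι).2 hi
    have h1 : ContMDiffAt 𝓘(ℝ, Cn n) 𝓘(ℝ, Cn n) ∞
        (fun q ↦ ι.map (down i (nearChart ι i q))) (line ℓ) := by
      refine ContMDiffAt.comp _ (g := ι.map) (ι.smooth.contMDiffAt (ι.map.open_source.mem_nhds ?_))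
        ((contDiff_down i).contMDiff.contMDiffAt.comp _
          (contMDiffAt_of_mem_maximalAtlas (nearChart_mem ι i) hp))
      exact ι.mem_source ((nearChart ι i).map_source hp)
    refine h1.congr_of_eventuallyEq ?_
    filter_upwards [(nearChart ι i).open_source.mem_nhds hp] with q hq
    exact proj_eq_nearChart ι hq
  · have he := chart_mem_atlas (Cn n) (proj ι p)
    have hp : p ∈ (awayChart ι p he).source := ⟨h, mem_chart_source _ _⟩
    have h1 : ContMDiffAt 𝓘(ℝ, Cn n) 𝓘(ℝ, Cn n) ∞
        (fun q ↦ (chartAt (Cn n) (proj ι p)).symm (awayChart ι p he q)) p := by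
      refine ContMDiffAt.comp _ (g := (chartAt (Cn n) (proj ι p)).symm)
        (contMDiffAt_symm_of_mem_maximalAtlas (IsManifold.subset_maximalAtlas he) ?_)
        (contMDiffAt_of_mem_maximalAtlas (awayChart_mem ι p he) hp)
      rw [awayChart_apply ι hp]
      exact mem_chart_target _ _
    refine h1.congr_of_eventuallyEq ?_
    filter_upwards [(awayChart ι p he).open_source.mem_nhds hp] with q hq
    rw [awayChart_apply ι hq, OpenPartialHomeomorph.left_inv _ hq.2]

theorem contMDiffAt_lift (p₀ : BlowUp ι) {x : X} (h : x ≠ ι.center) :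
    ContMDiffAt 𝓘(ℝ, Cn n) 𝓘(ℝ, Cn n) ∞ (lift ι p₀) x := by
  have he := chart_mem_atlas (Cn n) x
  have hx := mem_chart_source (Cn n) x
  have h1 : ContMDiffAt 𝓘(ℝ, Cn n) 𝓘(ℝ, Cn n) ∞
      (fun y ↦ (awayChart ι p₀ he).symm (chartAt (Cn n) x y)) x := by
    refine ContMDiffAt.comp _ (g := (awayChart ι p₀ he).symm)
      (contMDiffAt_symm_of_mem_maximalAtlas (awayChart_mem ι p₀ he)
        ⟨mem_chart_target _ _, ?_⟩)
      (contMDiffAt_of_mem_maximalAtlas (IsManifold.subset_maximalAtlas he) hx)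
    rwa [(chartAt (Cn n) x).left_inv hx]
  refine h1.congr_of_eventuallyEq ?_
  filter_upwards [(chartAt (Cn n) x).open_source.mem_nhds hx] with y hy
  rw [awayChart_symm_apply, (chartAt (Cn n) x).left_inv hy]

/-- The derivative of `π`. -/
def dproj (p : BlowUp ι) : Cn n →L[ℝ] Cn n := modelDeriv (E := Cn n) (E' := Cn n) (proj ι) p

/-- The derivative of `lift`. -/
def dlift (p₀ : BlowUp ι) (x : X) : Cn n →L[ℝ] Cn n :=
  modelDeriv (E := Cn n) (E' := Cn n) (lift ι p₀) x

theorem mdifferentiableAt_proj (p : BlowUp ι) :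
    MDifferentiableAt 𝓘(ℝ, Cn n) 𝓘(ℝ, Cn n) (proj ι) p :=
  (contMDiff_proj ι).mdifferentiableAt (by simp)

theorem mdifferentiableAt_lift (p₀ : BlowUp ι) {x : X} (h : x ≠ ι.center) :
    MDifferentiableAt 𝓘(ℝ, Cn n) 𝓘(ℝ, Cn n) (lift ι p₀) x :=
  (contMDiffAt_lift ι p₀ h).mdifferentiableAt (by simp)

theorem dlift_dproj (p₀ : BlowUp ι) {p : BlowUp ι} (h : proj ι p ≠ ι.center) (v : Cn n) :
    dlift ι p₀ (proj ι p) (dproj ι p v) = v := by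
  have h1 := modelDeriv_comp (E := Cn n) (E' := Cn n) (E'' := Cn n) p
    (mdifferentiableAt_lift ι p₀ h) (mdifferentiableAt_proj ι p)
  have h2 : (fun q ↦ lift ι p₀ (proj ι q)) =ᶠ[𝓝 p] fun q ↦ q := by
    filter_upwards [((contMDiff_proj ι).continuous.isOpen_preimage _
      (isOpen_compl_singleton (x := ι.center))).mem_nhds h] with q hq
    exact lift_proj ι p₀ hq
  rw [h2.modelDeriv_eq, modelDeriv_id] at h1
  exact (DFunLike.congr_fun h1 v).symm

theorem dproj_dlift (p₀ : BlowUp ι) {p : BlowUp ι} (h : proj ι p ≠ ι.center) (v : Cn n) :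
    dproj ι p (dlift ι p₀ (proj ι p) v) = v := by
  have h1 := modelDeriv_comp (E := Cn n) (E' := Cn n) (E'' := Cn n) (proj ι p)
    (g := proj ι) (mdifferentiableAt_proj ι _) (mdifferentiableAt_lift ι p₀ h)
  have h2 : (fun x ↦ proj ι (lift ι p₀ x)) =ᶠ[𝓝 (proj ι p)] fun x ↦ x := by
    filter_upwards [isOpen_compl_singleton.mem_nhds h] with q hq
    exact proj_lift ι p₀ hq
  rw [h2.modelDeriv_eq, modelDeriv_id, lift_proj ι p₀ h] at h1
  exact (DFunLike.congr_fun h1 v).symm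

theorem dproj_nearChart_symm {i : Fin n} {y : Cn n} (hy : y ∈ (nearChart ι i).target) (v : Cn n) :
    dproj ι ((nearChart ι i).symm y)
        (modelDeriv (E := Cn n) (E' := Cn n) (nearChart ι i).symm y v) =
      modelDeriv (E := Cn n) (E' := Cn n) ι.map (down i y) (fderiv ℝ (down i) y v) := by
  have h1 := modelDeriv_comp (E := Cn n) (E' := Cn n) (E'' := Cn n) y
    (mdifferentiableAt_proj ι ((nearChart ι i).symm y))
    ((mdifferentiable_of_mem_maximalAtlas (nearChart_mem ι i)).mdifferentiableAt_symm hy)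
  have h2 := modelDeriv_comp (E := Cn n) (E' := Cn n) (E'' := Cn n) y (g := ι.map) (f := down i)
    ((ι.smooth.contMDiffAt (ι.map.open_source.mem_nhds (ι.mem_source hy))).mdifferentiableAt
      (by simp)) ((contDiff_down i).contMDiff.contMDiffAt.mdifferentiableAt (by simp))
  have h3 : (fun y ↦ proj ι ((nearChart ι i).symm y)) =ᶠ[𝓝 y] fun y ↦ ι.map (down i y) := by
    filter_upwards [(nearChart ι i).open_target.mem_nhds hy] with z hz
    exact proj_nearChart_symm ι hz
  rw [h3.modelDeriv_eq, h2, modelDeriv_eq_fderiv] at h1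
  exact (DFunLike.congr_fun h1 v).symm

end BlowUp
end BlowUpStructure

/-! ### The almost complex structure of the blow up -/

noncomputable section BlowUpStructure

namespace BlowUp

variable {n : ℕ} {X : Type*} [TopologicalSpace X] [ChartedSpace (Cn n) X]
  [IsManifold 𝓘(ℝ, Cn n) ∞ X] [T2Space X] (ι : BallEmbedding n X)

/-- The derivative of the chart `nearChart`. -/
def dnear (i : Fin n) (p : BlowUp ι) : Cn n →L[ℝ] Cn n :=
  modelDeriv (E := Cn n) (E' := Cn n) (nearChart ι i) p

/-- The derivative of the inverse of the chart `nearChart`. -/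
def dnearSymm (i : Fin n) (y : Cn n) : Cn n →L[ℝ] Cn n :=
  modelDeriv (E := Cn n) (E' := Cn n) (nearChart ι i).symm y

theorem dnearSymm_dnear {i : Fin n} {p : BlowUp ι} (hp : p ∈ (nearChart ι i).source) (v : Cn n) :
    dnearSymm ι i (nearChart ι i p) (dnear ι i p v) = v :=
  (mdifferentiable_of_mem_maximalAtlas (nearChart_mem ι i)).modelDeriv_symm_apply hp v

theorem dnear_dnearSymm {i : Fin n} {p : BlowUp ι} (hp : p ∈ (nearChart ι i).source) (v : Cn n) :
    dnear ι i p (dnearSymm ι i (nearChart ι i p) v) = v := by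
  have h := (mdifferentiable_of_mem_maximalAtlas (nearChart_mem ι i)).modelDeriv_apply_symm
    ((nearChart ι i).map_source hp) v
  rwa [(nearChart ι i).left_inv hp] at h

theorem dproj_dnearSymm {i : Fin n} {p : BlowUp ι} (hp : p ∈ (nearChart ι i).source) (v : Cn n) :
    dproj ι p (dnearSymm ι i (nearChart ι i p) v) =
      modelDeriv (E := Cn n) (E' := Cn n) ι.map (down i (nearChart ι i p))
        (fderiv ℝ (down i) (nearChart ι i p) v) := by
  have h := dproj_nearChart_symm ι ((nearChart ι i).map_source hp) v
  rwa [(nearChart ι i).left_inv hp] at h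

/-- Since `π` is `ι ∘ down i` in the chart, with `down i` holomorphic and `ι*J = J₀` on the ball,
multiplication by `i` in the chart lies over `J`. This includes points of `E`, where `dπ` may fail
to be injective. -/
theorem dproj_dnearSymm_I {J : AlmostComplexStructure n X} (hJ : ι.PullsBackToStandard J)
    {i : Fin n} {p : BlowUp ι} (hp : p ∈ (nearChart ι i).source) (v : Cn n) :
    dproj ι p (dnearSymm ι i (nearChart ι i p) (Complex.I • dnear ι i p v)) =
      J.model (proj ι p) (dproj ι p v) := by
  rw [dproj_dnearSymm ι hp, fderiv_real_I_smul (differentiable_down i _), proj_eq_nearChart ι hp,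
    hJ.model ((nearChart ι i).map_source hp), ← dproj_dnearSymm ι hp, dnearSymm_dnear ι hp]

theorem nearChart_transition_apply {i j : Fin n} {y : Cn n} (hy : y ∈ (nearChart ι i).target) :
    nearChart ι j ((nearChart ι i).symm y) = coord j (down i y) (dir i y) :=
  nearFun_ofModel ι i j y hy

/-- The transition between two affine charts is holomorphic, so multiplication by `i` on the tangent
space at a point of `E` does not depend on the chart used. -/
theorem dnear_dnearSymm_I {i j : Fin n} {ℓ : Projectivization ℂ (Cn n)} (hi : ℓ.rep i ≠ 0)
    (hj : ℓ.rep j ≠ 0) (v : Cn n) :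
    dnear ι j (line ℓ) (dnearSymm ι i (nearChart ι i (line ℓ)) (Complex.I • dnear ι i (line ℓ) v)) =
      Complex.I • dnear ι j (line ℓ) v := by
  have hpi := (line_mem_nearChart_source ι).2 hi
  have hpj := (line_mem_nearChart_source ι).2 hj
  set y := nearChart ι i (line ℓ) with hy
  have hyt : y ∈ (nearChart ι i).target := (nearChart ι i).map_source hpi
  have hyl : (nearChart ι i).symm y = line ℓ := (nearChart ι i).left_inv hpi
  have hd : ∀ w, fderiv ℝ (fun y ↦ nearChart ι j ((nearChart ι i).symm y)) y w =
      dnear ι j (line ℓ) (dnearSymm ι i y w) := by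
    intro w
    rw [fderiv_transition (nearChart_mem ι i) (nearChart_mem ι j) hyt (by rwa [hyl]), hyl]
    rfl
  have h0 : dir i y j ≠ 0 := by
    have : dir i y j = ℓ.rep j / ℓ.rep i := by
      change dir i (coord i 0 ℓ.rep) j = _
      by_cases h : j = i
      · subst h; simp [dir, hi]
      · simp [dir, coord, h]
    rw [this]
    exact div_ne_zero hj hi
  have hdiff : DifferentiableAt ℂ (fun y ↦ nearChart ι j ((nearChart ι i).symm y)) y := by
    refine (differentiableAt_coord j (differentiable_down i y) (differentiable_dir i y)
      h0).congr_of_eventuallyEq ?_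
    filter_upwards [(nearChart ι i).open_target.mem_nhds hyt] with z hz
    exact nearChart_transition_apply ι hz
  rw [← hd, fderiv_real_I_smul hdiff, hd, hy, dnearSymm_dnear ι hpi]

variable (J : AlmostComplexStructure n X)

/-- The endomorphisms of the almost complex structure on the blow up. -/
def structureFun : BlowUp ι → (Cn n →L[ℝ] Cn n)
  | away x hx => (dlift ι (away x hx) x) ∘L (J.model x) ∘L (dproj ι (away x hx))
  -- The chosen affine chart is immaterial by `dnear_dnearSymm_I`.
  | line ℓ => (dnearSymm ι (exists_rep_ne_zero ℓ).choose
      (nearChart ι (exists_rep_ne_zero ℓ).choose (line ℓ))) ∘L (mulI n) ∘L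
        (dnear ι (exists_rep_ne_zero ℓ).choose (line ℓ))

theorem structureFun_away {p : BlowUp ι} (hp : proj ι p ≠ ι.center) (v : Cn n) :
    structureFun ι J p v = dlift ι p (proj ι p) (J.model (proj ι p) (dproj ι p v)) := by
  rcases p with ⟨x, hx⟩ | ℓ
  · rfl
  · exact (hp rfl).elim

variable {J}

theorem dproj_injective {p : BlowUp ι} (hp : proj ι p ≠ ι.center) :
    Function.Injective (dproj ι p) := fun v w h ↦ by
  rw [← dlift_dproj ι p hp v, h, dlift_dproj ι p hp w]

theorem dproj_structureFun (hJ : ι.PullsBackToStandard J) (p : BlowUp ι) (v : Cn n) :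
    dproj ι p (structureFun ι J p v) = J.model (proj ι p) (dproj ι p v) := by
  by_cases hp : proj ι p = ι.center
  · rcases p with ⟨x, hx⟩ | ℓ
    · exact (hx hp).elim
    · exact dproj_dnearSymm_I ι hJ
        ((line_mem_nearChart_source ι).2 (exists_rep_ne_zero ℓ).choose_spec) v
  · rw [structureFun_away ι J hp, dproj_dlift ι p hp]

/-- Off `E`, both the pullback of `J` and multiplication by `i` in the chart lie over `J`, and `dπ`
is injective, so they coincide. On `E` this is independence of the chart. Thus the structure is
constant in each affine chart, which gives its smoothness across `E`. -/
theorem dnear_structureFun (hJ : ι.PullsBackToStandard J) {i : Fin n} {p : BlowUp ι}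
    (hp : p ∈ (nearChart ι i).source) (v : Cn n) :
    dnear ι i p (structureFun ι J p v) = Complex.I • dnear ι i p v := by
  by_cases h : proj ι p = ι.center
  · rcases p with ⟨x, hx⟩ | ℓ
    · exact (hx h).elim
    · exact dnear_dnearSymm_I ι (exists_rep_ne_zero ℓ).choose_spec
        ((line_mem_nearChart_source ι).1 hp) v
  · have h1 : structureFun ι J p v =
        dnearSymm ι i (nearChart ι i p) (Complex.I • dnear ι i p v) := by
      apply dproj_injective ι h
      rw [dproj_structureFun ι hJ, dproj_dnearSymm_I ι hJ hp]
    rw [h1, dnear_dnearSymm ι hp]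

theorem chartRep_nearChart {T : BlowUp ι → Cn n →L[ℝ] Cn n} {i : Fin n} {y : Cn n}
    (hy : y ∈ (nearChart ι i).target)
    (h : ∀ v, dnear ι i ((nearChart ι i).symm y) (T ((nearChart ι i).symm y) v) =
      Complex.I • dnear ι i ((nearChart ι i).symm y) v) :
    chartRep (nearChart ι i) T y = mulI n := by
  ext1 v
  refine (h _).trans ?_
  have := dnear_dnearSymm ι ((nearChart ι i).map_target hy) v
  rw [(nearChart ι i).right_inv hy] at this
  exact congrArg (Complex.I • ·) this

/-- `π` is the identity with respect to `e` and the chart induced by `e`, so any field lying over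
`J` has the coordinate expression of `J`. -/
theorem chartRep_awayChart {T : BlowUp ι → Cn n →L[ℝ] Cn n} {p₀ : BlowUp ι}
    {e : OpenPartialHomeomorph X (Cn n)} (he : e ∈ atlas (Cn n) X)
    {y : Cn n} (hy : y ∈ (awayChart ι p₀ he).target)
    (h : ∀ v, dproj ι (lift ι p₀ (e.symm y)) (T (lift ι p₀ (e.symm y)) v) =
      J.model (e.symm y) (dproj ι (lift ι p₀ (e.symm y)) v)) :
    chartRep (awayChart ι p₀ he) T y = chartRep e J.model y := by
  have hye : y ∈ e.target := hy.1
  have hyc : e.symm y ≠ ι.center := hy.2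
  have he' := IsManifold.subset_maximalAtlas (I := 𝓘(ℝ, Cn n)) (n := ∞) he
  have hs : (awayChart ι p₀ he).symm y = lift ι p₀ (e.symm y) := rfl
  have hp : lift ι p₀ (e.symm y) ∈ (awayChart ι p₀ he).source := by
    rw [← hs]; exact (awayChart ι p₀ he).map_target hy
  have hproj := proj_lift ι p₀ hyc
  have h1 : modelDeriv (E := Cn n) (E' := Cn n) (awayChart ι p₀ he) (lift ι p₀ (e.symm y)) =
      (modelDeriv (E := Cn n) (E' := Cn n) e (e.symm y)) ∘L dproj ι (lift ι p₀ (e.symm y)) := by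
    have h2 : (awayChart ι p₀ he) =ᶠ[𝓝 (lift ι p₀ (e.symm y))] fun q ↦ e (proj ι q) := by
      filter_upwards [(awayChart ι p₀ he).open_source.mem_nhds hp] with q hq
      exact awayChart_apply ι hq
    rw [h2.modelDeriv_eq, modelDeriv_comp (E' := Cn n) _ _ (mdifferentiableAt_proj ι _), hproj]
    · rfl
    · rw [hproj]
      exact (mdifferentiable_of_mem_maximalAtlas he').mdifferentiableAt (e.map_target hye)
  have h3 : modelDeriv (E := Cn n) (E' := Cn n) (awayChart ι p₀ he).symm y =
      dlift ι p₀ (e.symm y) ∘L modelDeriv (E := Cn n) (E' := Cn n) e.symm y :=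
    modelDeriv_comp (E' := Cn n) y (mdifferentiableAt_lift ι p₀ hyc)
      ((mdifferentiable_of_mem_maximalAtlas he').mdifferentiableAt_symm hye)
  ext1 v
  have h4 := dproj_dlift ι p₀ (p := lift ι p₀ (e.symm y)) (by rwa [hproj])
  rw [hproj] at h4
  simp only [chartRep, hs, h1, h3, ContinuousLinearMap.coe_comp, Function.comp_apply, h, h4]

theorem structureFun_sq (hJ : ι.PullsBackToStandard J) (p : BlowUp ι) (v : Cn n) :
    structureFun ι J p (structureFun ι J p v) = -v := by
  by_cases h : proj ι p = ι.center
  · rcases p with ⟨x, hx⟩ | ℓ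
    · exact (hx h).elim
    · obtain ⟨i, hi⟩ := exists_rep_ne_zero ℓ
      have hp := (line_mem_nearChart_source ι).2 hi
      rw [← dnearSymm_dnear ι hp (structureFun ι J _ _), dnear_structureFun ι hJ hp,
        dnear_structureFun ι hJ hp, smul_smul, Complex.I_mul_I, neg_one_smul, map_neg,
        dnearSymm_dnear ι hp]
  · apply dproj_injective ι h
    rw [dproj_structureFun ι hJ, dproj_structureFun ι hJ, J.model_sq, map_neg]

/-- The almost complex structure on the blow up. -/
def almostComplexStructure (hJ : ι.PullsBackToStandard J) :
    AlmostComplexStructure n (BlowUp ι) where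
  toFun := structureFun ι J
  sq := structureFun_sq ι hJ
  smooth p := by
    by_cases h : proj ι p = ι.center
    · rcases p with ⟨x, hx⟩ | ℓ
      · exact (hx h).elim
      · obtain ⟨i, hi⟩ := exists_rep_ne_zero ℓ
        have hp := (line_mem_nearChart_source ι).2 hi
        refine (contMDiffAt_endomorphism_iff (structureFun ι J) (nearChart_mem ι i) hp).2 ?_
        refine (contDiffAt_const (c := mulI n)).congr_of_eventuallyEq ?_
        filter_upwards [(nearChart ι i).open_target.mem_nhds ((nearChart ι i).map_source hp)]
          with y hy
        exact chartRep_nearChart ι hy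
          fun v ↦ dnear_structureFun ι hJ ((nearChart ι i).map_target hy) v
    · have he := chart_mem_atlas (Cn n) (proj ι p)
      have hp : p ∈ (awayChart ι p he).source := ⟨h, mem_chart_source _ _⟩
      refine (contMDiffAt_endomorphism_iff (structureFun ι J) (awayChart_mem ι p he) hp).2 ?_
      have h1 := J.contDiffAt_chartRep (IsManifold.chart_mem_maximalAtlas _)
        (mem_chart_source (Cn n) (proj ι p))
      rw [← awayChart_apply ι hp] at h1
      refine h1.congr_of_eventuallyEq ?_
      filter_upwards [(awayChart ι p he).open_target.mem_nhds ((awayChart ι p he).map_source hp)]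
        with y hy
      refine chartRep_awayChart ι he hy fun v ↦ ?_
      have := dproj_structureFun ι hJ (lift ι p ((chartAt (Cn n) (proj ι p)).symm y)) v
      rwa [proj_lift ι p hy.2] at this

theorem isHolomorphicMap_proj (hJ : ι.PullsBackToStandard J) :
    IsHolomorphicMap (almostComplexStructure ι hJ) J (proj ι) :=
  ⟨contMDiff_proj ι, fun p v ↦ dproj_structureFun ι hJ p v⟩

/-- Holomorphy of `π` determines the structure wherever `dπ` is injective, in particular off `E`. On
`E` two continuous coordinate expressions that agree on a dense set agree. -/
theorem eq_almostComplexStructure (hJ : ι.PullsBackToStandard J)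
    {J' : AlmostComplexStructure n (BlowUp ι)} (h : IsHolomorphicMap J' J (proj ι)) :
    J' = almostComplexStructure ι hJ := by
  have h' : ∀ p v, dproj ι p (J'.model p v) = J.model (proj ι p) (dproj ι p v) := h.2
  have haway : ∀ p, proj ι p ≠ ι.center → ∀ v, J'.model p v = structureFun ι J p v := by
    intro p hp v
    apply dproj_injective ι hp
    rw [h', dproj_structureFun ι hJ]
  suffices h1 : ∀ p v, J'.model p v = structureFun ι J p v from
    AlmostComplexStructure.ext (funext fun p ↦ ContinuousLinearMap.ext fun v ↦ h1 p v)
  intro p v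
  by_cases hp : proj ι p = ι.center
  · rcases p with ⟨x, hx⟩ | ℓ
    · exact (hx hp).elim
    obtain ⟨i, hi⟩ := exists_rep_ne_zero ℓ
    have hpi := (line_mem_nearChart_source ι).2 hi
    have ht := (nearChart ι i).map_source hpi
    have hc := (J'.contDiffAt_chartRep (nearChart_mem ι i) hpi).continuousAt
    -- Off `E` the expression of `J'` in the affine chart is already known to be the constant `mulI
    -- n`; the limit at the point of `E` then gives the value there.
    have h2 : ∀ᶠ y in 𝓝[{y | y i ≠ 0}] (nearChart ι i (line ℓ)),
        chartRep (nearChart ι i) J'.model y = mulI n := by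
      filter_upwards [self_mem_nhdsWithin,
        nhdsWithin_le_nhds ((nearChart ι i).open_target.mem_nhds ht)] with y hy hyt
      refine chartRep_nearChart ι hyt fun v ↦ ?_
      rw [haway, dnear_structureFun ι hJ ((nearChart ι i).map_target hyt)]
      rw [proj_nearChart_symm ι hyt]
      exact ι.map_ne_center ⟨fun h ↦ hy (down_eq_zero.1 h), hyt⟩
    have : (𝓝[{y : Cn n | y i ≠ 0}] (nearChart ι i (line ℓ))).NeBot :=
      mem_closure_iff_nhdsWithin_neBot.1 (dense_apply_ne_zero i _)
    have h3 : chartRep (nearChart ι i) J'.model (nearChart ι i (line ℓ)) = mulI n :=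
      tendsto_nhds_unique (hc.mono_left nhdsWithin_le_nhds)
        (tendsto_const_nhds.congr' (h2.mono fun _ h ↦ h.symm))
    have h4 := DFunLike.congr_fun h3 (dnear ι i (line ℓ) v)
    have h5 : dnear ι i (line ℓ) (J'.model (line ℓ) v) = Complex.I • dnear ι i (line ℓ) v := by
      refine Eq.trans ?_ h4
      have h6 := dnearSymm_dnear ι hpi v
      simp only [dnearSymm, dnear] at h6
      simp only [chartRep, ContinuousLinearMap.coe_comp, Function.comp_apply,
        (nearChart ι i).left_inv hpi, dnear, h6]
    rw [← dnearSymm_dnear ι hpi (J'.model _ _), h5, ← dnear_structureFun ι hJ hpi,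
      dnearSymm_dnear ι hpi]
  · exact haway p hp v

end BlowUp
end BlowUpStructure

/-! ### Holomorphic disks near the base point: isolated zeros and finite order -/

section Disk

variable {n : ℕ} {X : Type*} [TopologicalSpace X] [ChartedSpace (Cn n) X]

theorem unitDisk_mem_nhds {z : ℂ} (hz : z ∈ Metric.ball (0 : ℂ) 1) : unitDisk ∈ 𝓝 z :=
  mem_of_superset (Metric.isOpen_ball.mem_nhds hz) Metric.ball_subset_closedBall

namespace BallEmbedding

variable (ι : BallEmbedding n X)

theorem symm_center : ι.map.symm ι.center = 0 := ι.map.left_inv ι.zero_mem_source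

theorem center_mem_target : ι.center ∈ ι.map.target := ι.map.map_source ι.zero_mem_source

theorem symm_eq_zero_iff {x : X} (hx : x ∈ ι.map.target) : ι.map.symm x = 0 ↔ x = ι.center := by
  constructor
  · intro h
    rw [← ι.map.right_inv hx, h]; rfl
  · rintro rfl; exact ι.symm_center

theorem eventually_mem_ball {u : ℂ → X} {z : ℂ} (hu : ContinuousAt u z) (hz : u z = ι.center) :
    ∀ᶠ w in 𝓝 z, u w ∈ ι.map.target ∧ ‖ι.map.symm (u w)‖ < ι.radius := by
  have h1 : ι.map.target ∩ ι.map.symm ⁻¹' Metric.ball 0 ι.radius ∈ 𝓝 (u z) := by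
    refine (ι.map.symm.isOpen_inter_preimage Metric.isOpen_ball).mem_nhds ⟨?_, ?_⟩
    · rw [hz]; exact ι.center_mem_target
    · simp [hz, ι.symm_center, ι.radius_pos]
  filter_upwards [hu h1] with w hw
  exact ⟨hw.1, by simpa using hw.2⟩

theorem mdifferentiable (ι : BallEmbedding n X) :
    ι.map.MDifferentiable 𝓘(ℝ, Cn n) 𝓘(ℝ, Cn n) :=
  ⟨ι.smooth.mdifferentiableOn (by simp), ι.smooth_symm.mdifferentiableOn (by simp)⟩

variable [IsManifold 𝓘(ℝ, Cn n) ∞ X]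

theorem PullsBackToStandard.modelDeriv_symm {ι : BallEmbedding n X}
    {J : AlmostComplexStructure n X}
    (h : ι.PullsBackToStandard J) {x : X} (hx : x ∈ ι.map.target)
    (hr : ‖ι.map.symm x‖ < ι.radius) (v : Cn n) :
    modelDeriv (E := Cn n) (E' := Cn n) ι.map.symm x (J.model x v) =
      Complex.I • modelDeriv (E := Cn n) (E' := Cn n) ι.map.symm x v := by
  have h1 := h.model hr (modelDeriv (E := Cn n) (E' := Cn n) ι.map.symm x v)
  rw [ι.mdifferentiable.modelDeriv_apply_symm hx, ι.map.right_inv hx] at h1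
  have h2 := ι.mdifferentiable.modelDeriv_symm_apply (ι.mem_source hr)
    (Complex.I • modelDeriv (E := Cn n) (E' := Cn n) ι.map.symm x v)
  rw [h1, ι.map.right_inv hx] at h2
  exact h2

end BallEmbedding

/-- The Cauchy–Riemann equations. -/
theorem differentiableAt_complex_of_real {F : Type*} [NormedAddCommGroup F] [NormedSpace ℂ F]
    {f : ℂ → F} {z : ℂ} (hf : DifferentiableAt ℝ f z)
    (h : ∀ v, fderiv ℝ f z (Complex.I * v) = Complex.I • fderiv ℝ f z v) :
    DifferentiableAt ℂ f z := by
  rw [differentiableAt_complex_iff_differentiableAt_real]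
  exact ⟨hf, by simpa using h 1⟩

variable [IsManifold 𝓘(ℝ, Cn n) ∞ X]

namespace IsHolomorphicDisk

variable {J : AlmostComplexStructure n X} {L : Set X} {u : ℂ → X} {ι : BallEmbedding n X}

theorem contMDiffAt (hu : IsHolomorphicDisk J L u) {z : ℂ} (hz : z ∈ Metric.ball (0 : ℂ) 1) :
    ContMDiffAt 𝓘(ℝ, ℂ) 𝓘(ℝ, Cn n) ∞ u z :=
  hu.smooth.contMDiffAt (unitDisk_mem_nhds hz)

theorem modelDeriv_I (hu : IsHolomorphicDisk J L u) {z : ℂ} (hz : z ∈ Metric.ball (0 : ℂ) 1)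
    (v : ℂ) : modelDeriv (E := ℂ) (E' := Cn n) u z (Complex.I * v) =
      J.model (u z) (modelDeriv (E := ℂ) (E' := Cn n) u z v) := by
  have h := hu.holomorphic z (Metric.ball_subset_closedBall hz) v
  rw [mfderivWithin_of_mem_nhds (unitDisk_mem_nhds hz)] at h
  exact h

theorem differentiableAt_symm (hu : IsHolomorphicDisk J L u) (hJ : ι.PullsBackToStandard J) {z : ℂ}
    (hz : z ∈ Metric.ball (0 : ℂ) 1) (hzt : u z ∈ ι.map.target)
    (hr : ‖ι.map.symm (u z)‖ < ι.radius) :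
    DifferentiableAt ℂ (fun w ↦ ι.map.symm (u w)) z := by
  have hd := (hu.contMDiffAt hz).mdifferentiableAt (by simp)
  have hs := ι.mdifferentiable.mdifferentiableAt_symm hzt
  have h1 := modelDeriv_comp (E := ℂ) (E' := Cn n) (E'' := Cn n) z hs hd
  rw [modelDeriv_eq_fderiv] at h1
  refine differentiableAt_complex_of_real (hs.comp z hd).differentiableAt fun v ↦ ?_
  simp only [h1, ContinuousLinearMap.coe_comp, Function.comp_apply, hu.modelDeriv_I hz,
    hJ.modelDeriv_symm hzt hr]

/-- Near `z` the disk stays in the ball where `J` is standard, so `ι⁻¹ ∘ u` is complex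
differentiable on a neighbourhood, hence analytic. -/
theorem analyticAt_symm (hu : IsHolomorphicDisk J L u) (hJ : ι.PullsBackToStandard J) {z : ℂ}
    (hz : z ∈ Metric.ball (0 : ℂ) 1) (hzc : u z = ι.center) :
    AnalyticAt ℂ (fun w ↦ ι.map.symm (u w)) z := by
  rw [Complex.analyticAt_iff_eventually_differentiableAt]
  filter_upwards [Metric.isOpen_ball.mem_nhds hz,
    ι.eventually_mem_ball (hu.contMDiffAt hz).continuousAt hzc] with w hw hwt
  exact hu.differentiableAt_symm hJ hw hwt.1 hwt.2

theorem mem_ball_of_eq_center (hu : IsHolomorphicDisk J L u) (hL : ι.center ∉ L) {z : ℂ}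
    (hz : z ∈ unitDisk) (hzc : u z = ι.center) : z ∈ Metric.ball (0 : ℂ) 1 := by
  by_contra h
  have h1 : z ∈ Metric.sphere (0 : ℂ) 1 := by
    simp only [unitDisk, Metric.mem_closedBall, Metric.mem_ball, Metric.mem_sphere] at *
    linarith
  exact hL (hzc ▸ hu.boundary z h1)

/-- An identity theorem for `u`: the set `B` of points near which `u` is constantly `x₀` is open,
and relatively closed in the open disk. If it contained `z`, then `u` would be `x₀` on the whole
open disk and, by continuity, on the boundary, contradicting `x₀ ∉ L`. -/
theorem not_eventually_eq_center [T2Space X] (hu : IsHolomorphicDisk J L u)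
    (hJ : ι.PullsBackToStandard J) (hL : ι.center ∉ L) {z : ℂ} (hz : z ∈ Metric.ball (0 : ℂ) 1) :
    ¬ ∀ᶠ w in 𝓝 z, u w = ι.center := by
  intro hev
  set B : Set ℂ := {w | ∀ᶠ w' in 𝓝 w, u w' = ι.center} with hB
  have hBo : IsOpen B := isOpen_iff_mem_nhds.2 fun w hw ↦ hw.eventually_nhds
  have hBc : ∀ w ∈ B, u w = ι.center := fun w hw ↦
    Eventually.self_of_nhds (p := fun w' ↦ u w' = ι.center) hw
  have hsub : Metric.ball (0 : ℂ) 1 ⊆ B := by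
    refine (convex_ball (0 : ℂ) 1).isPreconnected.subset_of_closure_inter_subset hBo
      ⟨z, hz, hev⟩ ?_
    rintro w ⟨hwc, hw⟩
    have hfr : ∃ᶠ w' in 𝓝 w, w' ∈ B := mem_closure_iff_frequently.1 hwc
    have hcont := (hu.contMDiffAt hw).continuousAt
    have hwu : u w = ι.center := by
      by_contra hne
      have h1 : ∀ᶠ w' in 𝓝 w, u w' ≠ ι.center := hcont.eventually_ne hne
      obtain ⟨w', h2, h3⟩ := (hfr.and_eventually h1).exists
      exact h3 (hBc _ h2)
    have hball := ι.eventually_mem_ball hcont hwu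
    rcases (hu.analyticAt_symm hJ hw hwu).eventually_eq_zero_or_eventually_ne_zero with h | h
    · change ∀ᶠ w' in 𝓝 w, u w' = ι.center
      filter_upwards [h, hball] with w' h1 h2
      exact (ι.symm_eq_zero_iff h2.1).1 h1
    -- Here `w` would be an isolated zero of `ι⁻¹ ∘ u`, although points of `B` accumulate at it.
    · by_contra hwB
      rw [eventually_nhdsWithin_iff] at h
      obtain ⟨w', h1, h2⟩ := (hfr.and_eventually h).exists
      refine h2 (fun h3 ↦ hwB (h3 ▸ h1)) ?_
      rw [hBc _ h1, ι.symm_center]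
  -- Any boundary point would do for the contradiction; the point `1` is used.
  have h1 : (1 : ℂ) ∈ closure (Metric.ball (0 : ℂ) 1) := by
    rw [closure_ball _ one_ne_zero]; simp
  have h1D : (1 : ℂ) ∈ unitDisk := by simp [unitDisk]
  have hc : ContinuousWithinAt u (Metric.ball (0 : ℂ) 1) 1 :=
    (hu.smooth.continuousOn 1 h1D).mono Metric.ball_subset_closedBall
  have h2 : u 1 ∈ closure {ι.center} :=
    hc.mem_closure h1 fun w hw ↦ hBc _ (hsub hw)
  rw [closure_singleton] at h2
  exact hL (h2 ▸ hu.boundary 1 (by simp))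

theorem eventually_ne_center [T2Space X] (hu : IsHolomorphicDisk J L u)
    (hJ : ι.PullsBackToStandard J) (hL : ι.center ∉ L) {z : ℂ} (hz : z ∈ Metric.ball (0 : ℂ) 1)
    (hzc : u z = ι.center) : ∀ᶠ w in 𝓝[≠] z, u w ≠ ι.center := by
  have hball := ι.eventually_mem_ball (hu.contMDiffAt hz).continuousAt hzc
  rcases (hu.analyticAt_symm hJ hz hzc).eventually_eq_zero_or_eventually_ne_zero with h | h
  · refine (hu.not_eventually_eq_center hJ hL hz ?_).elim
    filter_upwards [h, hball] with w' h1 h2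
    exact (ι.symm_eq_zero_iff h2.1).1 h1
  · filter_upwards [h] with w hw h1
    exact hw (by rw [h1, ι.symm_center])

/-- An infinite preimage would accumulate in the compact disk. The accumulation point is again a
preimage of `x₀`, hence interior, and preimages there are isolated. -/
theorem finite_preimage_center [T2Space X] (hu : IsHolomorphicDisk J L u)
    (hJ : ι.PullsBackToStandard J) (hL : ι.center ∉ L) :
    {z | z ∈ unitDisk ∧ u z = ι.center}.Finite := by
  by_contra hinf
  obtain ⟨z, hz, hacc⟩ := Set.Infinite.exists_accPt_of_subset_isCompact hinf
    (isCompact_closedBall (0 : ℂ) 1) fun z hz ↦ hz.1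
  rw [accPt_iff_frequently] at hacc
  have hzc : u z = ι.center := by
    have h1 : z ∈ closure {z | z ∈ unitDisk ∧ u z = ι.center} :=
      mem_closure_iff_frequently.2 (hacc.mono fun _ h ↦ h.2)
    have h2 : u z ∈ closure {ι.center} :=
      ((hu.smooth.continuousOn z hz).mono fun w hw ↦ hw.1).mem_closure h1 fun w hw ↦ hw.2
    rwa [closure_singleton] at h2
  have h := hu.eventually_ne_center hJ hL (hu.mem_ball_of_eq_center hL hz hzc) hzc
  rw [eventually_nhdsWithin_iff] at h
  obtain ⟨w, h1, h2⟩ := (hacc.and_eventually h).exists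
  exact h2 h1.1 h1.2.2

end IsHolomorphicDisk

/-- `f` is `(w - z) ^ k • h w` near `z`, with `h` holomorphic and not vanishing at `z`. -/
structure HasLeadingFactor (f : ℂ → Cn n) (z : ℂ) (k : ℕ) (h : ℂ → Cn n) : Prop where
  analyticAt : AnalyticAt ℂ h z
  ne_zero : h z ≠ 0
  eventually_eq : ∀ᶠ w in 𝓝 z, f w = (w - z) ^ k • h w

theorem IsHolomorphicDisk.exists_leadingFactor [T2Space X] {J : AlmostComplexStructure n X}
    {L : Set X} {u : ℂ → X} {ι : BallEmbedding n X} (hu : IsHolomorphicDisk J L u)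
    (hJ : ι.PullsBackToStandard J) (hL : ι.center ∉ L) {z : ℂ} (hz : z ∈ unitDisk)
    (hzc : u z = ι.center) :
    ∃ k : ℕ, analyticOrderAt (fun w ↦ ι.map.symm (u w)) z = k ∧
      ∃ h, HasLeadingFactor (fun w ↦ ι.map.symm (u w)) z k h := by
  have hzb := hu.mem_ball_of_eq_center hL hz hzc
  have han := hu.analyticAt_symm hJ hzb hzc
  have hne : analyticOrderAt (fun w ↦ ι.map.symm (u w)) z ≠ ⊤ := by
    intro htop
    rw [analyticOrderAt_eq_top] at htop
    refine hu.not_eventually_eq_center hJ hL hzb ?_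
    filter_upwards [htop, ι.eventually_mem_ball (hu.contMDiffAt hzb).continuousAt hzc] with w h1 h2
    exact (ι.symm_eq_zero_iff h2.1).1 h1
  obtain ⟨k, hk⟩ := ENat.ne_top_iff_exists.1 hne
  obtain ⟨h, h1, h2, h3⟩ := han.analyticOrderAt_eq_natCast.1 hk.symm
  exact ⟨k, hk.symm, h, h1, h2, h3⟩

end Disk

/-! ### Constraints on a continuous lift over the base point -/

namespace BlowUp

variable {n : ℕ} {X : Type*} [TopologicalSpace X] [ChartedSpace (Cn n) X]

theorem proj_injective_away (ι : BallEmbedding n X) {p q : BlowUp ι} (h : proj ι p = proj ι q)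
    (hp : proj ι p ≠ ι.center) : p = q := by
  rw [← lift_proj ι p hp, h, lift_proj ι p (h ▸ hp)]

theorem dir_coord (i : Fin n) (z w : Cn n) (hw : w i ≠ 0) :
    dir i (coord i z w) = (w i)⁻¹ • w := by
  ext k
  by_cases hk : k = i
  · subst hk; simp [dir, hw]
  · simp [dir, coord, hk, div_eq_inv_mul]

variable [IsManifold 𝓘(ℝ, Cn n) ∞ X] [T2Space X] (ι : BallEmbedding n X)

/-- With `y` the chart coordinates of `v w`, lifting `u` means `(w - z)^k h(w) = y i • dir i y`. The
`i`-th entry gives `y i`, because `dir i y` has `i`-th entry `1`. Cancelling `(w - z)^k` for `w ≠ z`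
and letting `w → z` gives the direction. The first part serves the intersection index, the second
the uniqueness of the lift. -/
theorem nearChart_apply_of_lift {u : ℂ → X} {v : ℂ → BlowUp ι} {z : ℂ} {k : ℕ} {h : ℂ → Cn n}
    {i : Fin n} (hv : ContinuousAt v z) (hproj : ∀ᶠ w in 𝓝 z, proj ι (v w) = u w)
    (hf : HasLeadingFactor (fun w ↦ ι.map.symm (u w)) z k h)
    (hi : v z ∈ (nearChart ι i).source) :
    (∀ᶠ w in 𝓝 z, nearChart ι i (v w) i = (w - z) ^ k * h w i) ∧
      h z = h z i • dir i (nearChart ι i (v z)) := by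
  have hev : ∀ᶠ w in 𝓝 z, (w - z) ^ k • h w = down i (nearChart ι i (v w)) := by
    filter_upwards [hproj, hf.eventually_eq, hv ((nearChart ι i).open_source.mem_nhds hi)]
      with w h1 h2 h3
    rw [← h2, ← h1, proj_eq_nearChart ι h3,
      ι.map.left_inv (ι.mem_source ((nearChart ι i).map_source h3))]
  have hcoord : ∀ᶠ w in 𝓝 z, nearChart ι i (v w) i = (w - z) ^ k * h w i := by
    filter_upwards [hev] with w hw
    rw [← down_self i (nearChart ι i (v w)), ← hw]
    simp
  refine ⟨hcoord, ?_⟩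
  have hpunct : ∀ᶠ w in 𝓝[≠] z, h w = h w i • dir i (nearChart ι i (v w)) := by
    filter_upwards [nhdsWithin_le_nhds hev, nhdsWithin_le_nhds hcoord, self_mem_nhdsWithin]
      with w h1 h2 h3
    have h4 : (w - z) ^ k ≠ 0 := pow_ne_zero _ (sub_ne_zero.2 h3)
    rw [down, h2, mul_smul] at h1
    exact smul_right_injective _ h4 h1
  have hhc : ContinuousAt h z := hf.analyticAt.continuousAt
  have hic : ContinuousAt (fun w ↦ h w i) z :=
    (EuclideanSpace.proj i : Cn n →L[ℂ] ℂ).continuous.continuousAt.comp hhc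
  have hnc : ContinuousAt (fun w ↦ nearChart ι i (v w)) z :=
    ((nearChart ι i).continuousAt hi).comp hv
  have hdc : ContinuousAt (fun w ↦ h w i • dir i (nearChart ι i (v w))) z :=
    hic.smul ((contDiff_dir i).continuous.continuousAt.comp hnc)
  exact tendsto_nhds_unique (hhc.mono_left nhdsWithin_le_nhds)
    ((hdc.mono_left nhdsWithin_le_nhds).congr' (hpunct.mono fun _ h ↦ h.symm))

theorem ne_zero_of_lift {u : ℂ → X} {v : ℂ → BlowUp ι} {z : ℂ} {k : ℕ} {h : ℂ → Cn n}
    {i : Fin n} (hv : ContinuousAt v z) (hproj : ∀ᶠ w in 𝓝 z, proj ι (v w) = u w)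
    (hf : HasLeadingFactor (fun w ↦ ι.map.symm (u w)) z k h)
    (hi : v z ∈ (nearChart ι i).source) : h z i ≠ 0 := fun h0 ↦ by
  have := (nearChart_apply_of_lift ι hv hproj hf hi).2
  rw [h0, zero_smul] at this
  exact hf.ne_zero this

/-- Continuity alone forces the value of a lift over `x₀`: the lines spanned by `ι⁻¹(u w)` converge
to the line spanned by the leading coefficient. -/
theorem eq_line_of_lift {u : ℂ → X} {v : ℂ → BlowUp ι} {z : ℂ} {k : ℕ} {h : ℂ → Cn n}
    (hv : ContinuousAt v z) (hproj : ∀ᶠ w in 𝓝 z, proj ι (v w) = u w) (hz : u z = ι.center)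
    (hf : HasLeadingFactor (fun w ↦ ι.map.symm (u w)) z k h) :
    v z = line (Projectivization.mk ℂ (h z) hf.ne_zero) := by
  have hc : proj ι (v z) = ι.center := by rw [mem_of_mem_nhds hproj, hz]
  rcases hvz : v z with ⟨x, hx⟩ | ℓ
  · rw [hvz] at hc; exact (hx hc).elim
  obtain ⟨i, hi⟩ := exists_rep_ne_zero ℓ
  have hi' := (line_mem_nearChart_source ι).2 hi
  rw [← hvz] at hi'
  have h1 := (nearChart_apply_of_lift ι hv hproj hf hi').2
  have h2 : nearChart ι i (v z) = coord i 0 ℓ.rep := by rw [hvz]; rfl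
  rw [h2, dir_coord i _ _ hi, smul_smul] at h1
  congr 1
  conv_lhs => rw [← ℓ.mk_rep]
  symm
  rw [Projectivization.mk_eq_mk_iff']
  exact ⟨_, h1.symm⟩

end BlowUp

/-! ### Existence and uniqueness of the lifted disk -/

section LiftDisk

variable {n : ℕ} {X : Type*} [TopologicalSpace X] [ChartedSpace (Cn n) X]
  [IsManifold 𝓘(ℝ, Cn n) ∞ X]

theorem uniqueMDiffWithinAt_unitDisk {z : ℂ} (hz : z ∈ unitDisk) :
    UniqueMDiffWithinAt 𝓘(ℝ, ℂ) unitDisk z := by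
  rw [uniqueMDiffWithinAt_iff_uniqueDiffWithinAt]
  refine uniqueDiffOn_convex (convex_closedBall (0 : ℂ) 1) ⟨0, ?_⟩ z hz
  rw [interior_closedBall _ one_ne_zero]
  simp

namespace BlowUp

variable [T2Space X] (ι : BallEmbedding n X) {J : AlmostComplexStructure n X}

theorem structureFun_dlift (p₀ : BlowUp ι) {x : X} (hx : x ≠ ι.center) (w : Cn n) :
    structureFun ι J (lift ι p₀ x) (dlift ι p₀ x w) = dlift ι p₀ x (J.model x w) := by
  have hx' : proj ι (lift ι p₀ x) ≠ ι.center := by rwa [proj_lift ι p₀ hx]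
  apply dproj_injective ι hx'
  -- The definition of `structureFun` uses the point itself as irrelevant value of `lift`, the
  -- statement uses `p₀`. Either derivative is a right inverse of `dπ`.
  have h1 := fun w ↦ dproj_dlift ι p₀ hx' w
  have h2 := fun w ↦ dproj_dlift ι (lift ι p₀ x) hx' w
  simp only [proj_lift ι p₀ hx] at h1 h2
  rw [structureFun_away ι J hx', h1, proj_lift ι p₀ hx, h2, h1]

theorem structureFun_dnearSymm (hJ : ι.PullsBackToStandard J) {i : Fin n} {y : Cn n}
    (hy : y ∈ (nearChart ι i).target) (w : Cn n) :
    structureFun ι J ((nearChart ι i).symm y) (dnearSymm ι i y w) =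
      dnearSymm ι i y (Complex.I • w) := by
  have hp := (nearChart ι i).map_target hy
  have h1 := dnearSymm_dnear ι hp
    (structureFun ι J ((nearChart ι i).symm y) (dnearSymm ι i y w))
  have h2 := dnear_dnearSymm ι hp w
  rw [(nearChart ι i).right_inv hy] at h1 h2
  rw [← h1, dnear_structureFun ι hJ hp, h2]

/-- Here `v` is `u` followed by the local inverse of `π`. This case includes all boundary points,
hence the derivatives within the disk. -/
theorem lift_disk_away {u : ℂ → X} {v : ℂ → BlowUp ι} {L : Set X} (hu : IsHolomorphicDisk J L u)
    (hv : ∀ z ∈ unitDisk, proj ι (v z) = u z) {z : ℂ} (hz : z ∈ unitDisk)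
    (hzc : u z ≠ ι.center) :
    ContMDiffWithinAt 𝓘(ℝ, ℂ) 𝓘(ℝ, Cn n) ∞ v unitDisk z ∧
    ∀ w : ℂ, mfderivWithin 𝓘(ℝ, ℂ) 𝓘(ℝ, Cn n) v unitDisk z (Complex.I * w : ℂ) =
      structureFun ι J (v z) (mfderivWithin 𝓘(ℝ, ℂ) 𝓘(ℝ, Cn n) v unitDisk z w) := by
  have hus := hu.smooth z hz
  have hev : v =ᶠ[𝓝[unitDisk] z] lift ι (v z) ∘ u := by
    filter_upwards [hus.continuousWithinAt (isOpen_compl_singleton.mem_nhds hzc),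
      self_mem_nhdsWithin] with w hw hwD
    have hw : u w ≠ ι.center := hw
    change v w = lift ι (v z) (u w)
    rw [← hv w hwD] at hw ⊢
    exact (lift_proj ι _ hw).symm
  have hvz : v z = (lift ι (v z) ∘ u) z := hev.self_of_nhdsWithin hz
  refine ⟨((contMDiffAt_lift ι (v z) hzc).comp_contMDiffWithinAt z hus).congr_of_eventuallyEq hev
    hvz, fun w ↦ ?_⟩
  have hd : ∀ w : ℂ, mfderivWithin 𝓘(ℝ, ℂ) 𝓘(ℝ, Cn n) v unitDisk z w =
      dlift ι (v z) (u z) (mfderivWithin 𝓘(ℝ, ℂ) 𝓘(ℝ, Cn n) u unitDisk z w) := by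
    intro w
    have h1 := hev.mfderivWithin_eq (I := 𝓘(ℝ, ℂ)) (I' := 𝓘(ℝ, Cn n)) hvz
    have h2 := mfderiv_comp_mfderivWithin (I := 𝓘(ℝ, ℂ)) (I' := 𝓘(ℝ, Cn n)) (I'' := 𝓘(ℝ, Cn n)) z
      (mdifferentiableAt_lift ι (v z) hzc) (hus.mdifferentiableWithinAt (by simp))
      (uniqueMDiffWithinAt_unitDisk hz)
    exact DFunLike.congr_fun (h1.trans h2) w
  refine (hd _).trans (Eq.trans ?_ (congrArg (structureFun ι J (v z)) (hd w)).symm)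
  refine (congrArg (dlift ι (v z) (u z)) (hu.holomorphic z hz w)).trans ?_
  have h3 := structureFun_dlift ι (J := J) (v z) hzc
    (mfderivWithin 𝓘(ℝ, ℂ) 𝓘(ℝ, Cn n) u unitDisk z w)
  have hvz' : lift ι (v z) (u z) = v z := hvz.symm
  rw [hvz'] at h3
  exact h3.symm

/-- The formula for the lift through the singular point: use the pair `(ι⁻¹(u w), ℂ h(w))`. For `w ≠
z` the two vectors are proportional, and the line coordinates ignore the factor `(w - z)^k`; at `w =
z` only `h` still defines a line. -/
theorem eventually_eq_nearChart_symm {u : ℂ → X} {v : ℂ → BlowUp ι} {z : ℂ} {k : ℕ}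
    {h : ℂ → Cn n} {i : Fin n} (hu : ContinuousAt u z)
    (hv : ∀ᶠ w in 𝓝 z, proj ι (v w) = u w) (hz : u z = ι.center)
    (hne : ∀ᶠ w in 𝓝[≠] z, u w ≠ ι.center)
    (hf : HasLeadingFactor (fun w ↦ ι.map.symm (u w)) z k h)
    (hvz : v z = line (Projectivization.mk ℂ (h z) hf.ne_zero)) (hi : h z i ≠ 0) :
    ∀ᶠ w in 𝓝 z, coord i (ι.map.symm (u w)) (h w) ∈ (nearChart ι i).target ∧
      v w = (nearChart ι i).symm (coord i (ι.map.symm (u w)) (h w)) := by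
  have hic : ∀ᶠ w in 𝓝 z, h w i ≠ 0 :=
    ((EuclideanSpace.proj i : Cn n →L[ℂ] ℂ).continuous.continuousAt.comp
      hf.analyticAt.continuousAt).eventually_ne hi
  rw [eventually_nhdsWithin_iff] at hne
  filter_upwards [hic, hne, hf.eventually_eq, hv, ι.eventually_mem_ball hu hz]
    with w hwi hwne hwf hwv hwb
  by_cases hwz : w = z
  · subst hwz
    have h0 : down i (coord i (ι.map.symm (u w)) (h w)) = 0 := by
      simp [down_eq_zero, coord, hz, ι.symm_center]
    refine ⟨by simpa [mem_nearChart_target, h0] using ι.radius_pos, ?_⟩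
    rw [hvz, nearChart_symm_apply, ofModel_of_eq ι h0]
    congr 1
    symm
    rw [Projectivization.mk_eq_mk_iff']
    exact ⟨_, (dir_coord i _ _ hi).symm⟩
  · have hc : (w - z) ^ k ≠ 0 := pow_ne_zero _ (sub_ne_zero.2 hwz)
    have h1 : coord i (ι.map.symm (u w)) (h w) =
        coord i (ι.map.symm (u w)) (ι.map.symm (u w)) := by
      conv_rhs => arg 3; rw [hwf]
      exact (coord_smul i _ _ hc).symm
    have h2 : down i (coord i (ι.map.symm (u w)) (h w)) = ι.map.symm (u w) := by
      rw [h1]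
      refine down_coord ?_
      rw [hwf]
      simp [sub_eq_zero, hwz, hwi]
    have h3 : coord i (ι.map.symm (u w)) (h w) ∈ (nearChart ι i).target := by
      rw [mem_nearChart_target, h2]; exact hwb.2
    refine ⟨h3, proj_injective_away ι ?_ (hwv ▸ hwne hwz)⟩
    rw [proj_nearChart_symm ι h3, h2, ι.map.right_inv hwb.1, hwv]

/-- In an affine chart the lift is the map `g`, a quotient of holomorphic functions with denominator
`h_i ≠ 0`, and the structure is multiplication by `i`. Smoothness and holomorphy of `v` follow. -/
theorem lift_disk_near (hJ : ι.PullsBackToStandard J) {u : ℂ → X} {v : ℂ → BlowUp ι} {L : Set X}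
    (hu : IsHolomorphicDisk J L u) (hL : ι.center ∉ L)
    (hv : ∀ z ∈ unitDisk, proj ι (v z) = u z) {z : ℂ} (hz : z ∈ unitDisk)
    (hzc : u z = ι.center) {k : ℕ} {h : ℂ → Cn n}
    (hf : HasLeadingFactor (fun w ↦ ι.map.symm (u w)) z k h)
    (hvz : v z = line (Projectivization.mk ℂ (h z) hf.ne_zero)) :
    ContMDiffWithinAt 𝓘(ℝ, ℂ) 𝓘(ℝ, Cn n) ∞ v unitDisk z ∧
    ∀ w : ℂ, mfderivWithin 𝓘(ℝ, ℂ) 𝓘(ℝ, Cn n) v unitDisk z (Complex.I * w : ℂ) =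
      structureFun ι J (v z) (mfderivWithin 𝓘(ℝ, ℂ) 𝓘(ℝ, Cn n) v unitDisk z w) := by
  have hzb := hu.mem_ball_of_eq_center hL hz hzc
  obtain ⟨i, hi⟩ : ∃ i, h z i ≠ 0 := by
    by_contra! h0
    exact hf.ne_zero (by ext k; simpa using h0 k)
  set g : ℂ → Cn n := fun w ↦ coord i (ι.map.symm (u w)) (h w) with hg
  have hproj : ∀ᶠ w in 𝓝 z, proj ι (v w) = u w := by
    filter_upwards [unitDisk_mem_nhds hzb] with w hw using hv w hw
  have hev := eventually_eq_nearChart_symm ι (hu.contMDiffAt hzb).continuousAt hproj hzc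
    (hu.eventually_ne_center hJ hL hzb hzc) hf hvz hi
  have hga : AnalyticAt ℂ g z := by
    rw [Complex.analyticAt_iff_eventually_differentiableAt]
    have hic : ∀ᶠ w in 𝓝 z, h w i ≠ 0 :=
      ((EuclideanSpace.proj i : Cn n →L[ℂ] ℂ).continuous.continuousAt.comp
        hf.analyticAt.continuousAt).eventually_ne hi
    filter_upwards [hic, (Complex.analyticAt_iff_eventually_differentiableAt).1 hf.analyticAt,
      (Complex.analyticAt_iff_eventually_differentiableAt).1 (hu.analyticAt_symm hJ hzb hzc)]
      with w h1 h2 h3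
    exact differentiableAt_coord i h3 h2 h1
  have hgs : ContDiffAt ℝ ∞ g z := hga.contDiffAt.restrict_scalars ℝ
  have ht : g z ∈ (nearChart ι i).target := hev.self_of_nhds.1
  have hvg : v z = (nearChart ι i).symm (g z) := hev.self_of_nhds.2
  have hev' : v =ᶠ[𝓝 z] fun w ↦ (nearChart ι i).symm (g w) := hev.mono fun w hw ↦ hw.2
  have hsm : ContMDiffAt 𝓘(ℝ, ℂ) 𝓘(ℝ, Cn n) ∞ (fun w ↦ (nearChart ι i).symm (g w)) z :=
    (contMDiffAt_symm_of_mem_maximalAtlas (nearChart_mem ι i) ht).comp z hgs.contMDiffAt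
  refine ⟨(hsm.congr_of_eventuallyEq hev').contMDiffWithinAt, fun w ↦ ?_⟩
  rw [mfderivWithin_of_mem_nhds (unitDisk_mem_nhds hzb)]
  change modelDeriv (E := ℂ) (E' := Cn n) v z (Complex.I * w) =
    structureFun ι J (v z) (modelDeriv (E := ℂ) (E' := Cn n) v z w)
  have hd : modelDeriv (E := ℂ) (E' := Cn n) v z = dnearSymm ι i (g z) ∘L fderiv ℝ g z := by
    rw [hev'.modelDeriv_eq, ← modelDeriv_eq_fderiv]
    exact modelDeriv_comp (E' := Cn n) z
      ((mdifferentiable_of_mem_maximalAtlas (nearChart_mem ι i)).mdifferentiableAt_symm ht)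
      (hgs.contMDiffAt.mdifferentiableAt (by simp))
  have hI := fderiv_real_I_smul hga.differentiableAt w
  rw [smul_eq_mul] at hI
  rw [hd, hvg]
  simp only [ContinuousLinearMap.coe_comp, Function.comp_apply]
  rw [hI, structureFun_dnearSymm ι hJ ht]

theorem exists_lift_disk (hJ : ι.PullsBackToStandard J) {u : ℂ → X} {L : Set X}
    (hu : IsHolomorphicDisk J L u) (hL : ι.center ∉ L) :
    ∃ v : ℂ → BlowUp ι, IsHolomorphicDisk (almostComplexStructure ι hJ) (proj ι ⁻¹' L) v ∧
      ∀ z ∈ unitDisk, proj ι (v z) = u z := by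
  -- The lift can be chosen point by point: off `x₀` its value is forced, and over `x₀` it is the
  -- line of a leading coefficient. Regularity is then checked locally.
  have hex : ∀ z ∈ unitDisk, ∃ p : BlowUp ι, proj ι p = u z ∧ (u z = ι.center →
      ∃ k h, ∃ hf : HasLeadingFactor (fun w ↦ ι.map.symm (u w)) z k h,
        p = line (Projectivization.mk ℂ (h z) hf.ne_zero)) := by
    intro z hz
    by_cases hzc : u z = ι.center
    · obtain ⟨k, -, h, hf⟩ := hu.exists_leadingFactor hJ hL hz hzc
      exact ⟨line (Projectivization.mk ℂ (h z) hf.ne_zero), hzc.symm, fun _ ↦ ⟨k, h, hf, rfl⟩⟩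
    · exact ⟨away (u z) hzc, rfl, fun h ↦ (hzc h).elim⟩
  have : Nonempty (BlowUp ι) := ⟨(hex 0 (by simp [unitDisk])).choose⟩
  choose! v hv hvc using hex
  have key : ∀ z ∈ unitDisk, ContMDiffWithinAt 𝓘(ℝ, ℂ) 𝓘(ℝ, Cn n) ∞ v unitDisk z ∧
      ∀ w : ℂ, mfderivWithin 𝓘(ℝ, ℂ) 𝓘(ℝ, Cn n) v unitDisk z (Complex.I * w : ℂ) =
        structureFun ι J (v z) (mfderivWithin 𝓘(ℝ, ℂ) 𝓘(ℝ, Cn n) v unitDisk z w) := by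
    intro z hz
    by_cases hzc : u z = ι.center
    · obtain ⟨k, h, hf, hvz⟩ := hvc z hz hzc
      exact lift_disk_near ι hJ hu hL hv hz hzc hf hvz
    · exact lift_disk_away ι hu hv hz hzc
  refine ⟨v, ⟨fun z hz ↦ (key z hz).1, fun z hz ↦ (key z hz).2, fun z hz ↦ ?_⟩, hv⟩
  change proj ι (v z) ∈ L
  rw [hv z (Metric.sphere_subset_closedBall hz)]
  exact hu.boundary z hz

theorem lift_disk_unique (hJ : ι.PullsBackToStandard J) {u : ℂ → X} {L : Set X}
    (hu : IsHolomorphicDisk J L u) (hL : ι.center ∉ L) {v v' : ℂ → BlowUp ι}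
    (hvc : ContinuousOn v unitDisk) (hvc' : ContinuousOn v' unitDisk)
    (hv : ∀ z ∈ unitDisk, proj ι (v z) = u z) (hv' : ∀ z ∈ unitDisk, proj ι (v' z) = u z) :
    EqOn v' v unitDisk := by
  intro z hz
  by_cases hzc : u z = ι.center
  · obtain ⟨k, -, h, hf⟩ := hu.exists_leadingFactor hJ hL hz hzc
    have hnhds := unitDisk_mem_nhds (hu.mem_ball_of_eq_center hL hz hzc)
    rw [eq_line_of_lift ι (hvc.continuousAt hnhds) (eventually_of_mem hnhds hv) hzc hf,
      eq_line_of_lift ι (hvc'.continuousAt hnhds) (eventually_of_mem hnhds hv') hzc hf]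
  · exact proj_injective_away ι ((hv' z hz).trans (hv z hz).symm) (by rwa [hv' z hz])

end BlowUp

end LiftDisk

/-! ### Winding numbers and real-linear maps of the plane -/

section Winding

/-- On a small circle the factors `p` and `q` have continuous principal logarithms that return to
their initial values. Only `(w - z)^k`, with logarithm `k (log r + i t)`, contributes an increment.
-/
theorem eventually_hasWindingNumber {φ p q : ℂ → ℂ} {z C : ℂ} {k : ℕ} (hC : C ≠ 0)
    (h : ∀ᶠ w in 𝓝[≠] z, φ w = C * (w - z) ^ k * p w * q w ∧ p w ∈ Complex.slitPlane ∧
      q w ∈ Complex.slitPlane ∧ ContinuousAt p w ∧ ContinuousAt q w) :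
    ∀ᶠ r in 𝓝[>] (0 : ℝ), HasWindingNumber (fun t ↦ φ (circleMap z r t)) k := by
  rw [eventually_nhdsWithin_iff, Metric.eventually_nhds_iff] at h
  obtain ⟨ε, hε, h⟩ := h
  filter_upwards [Ioo_mem_nhdsGT hε] with r hr
  have hcirc : ∀ t, circleMap z r t - z = r * Complex.exp (t * Complex.I) := fun t ↦ by
    simp [circleMap]
  have hr0 : (r : ℂ) ≠ 0 := by exact_mod_cast hr.1.ne'
  have hP : ∀ t, _ := fun t ↦ h (y := circleMap z r t)
    (by rw [dist_eq_norm, hcirc]; simpa [abs_of_pos hr.1] using hr.2)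
    (by
      rw [mem_compl_singleton_iff, ← sub_ne_zero, hcirc]
      exact mul_ne_zero hr0 (Complex.exp_ne_zero _))
  have hcc : Continuous (circleMap z r) := continuous_circleMap z r
  refine ⟨fun t ↦ Complex.log C + k * (Complex.log r + t * Complex.I) +
    Complex.log (p (circleMap z r t)) + Complex.log (q (circleMap z r t)), ?_, fun t ↦ ?_, ?_⟩
  · have h1 : Continuous fun t ↦ Complex.log (p (circleMap z r t)) :=
      continuous_iff_continuousAt.2 fun t ↦
        ((hP t).2.2.2.1.comp (f := circleMap z r) hcc.continuousAt).clog (hP t).2.1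
    have h2 : Continuous fun t ↦ Complex.log (q (circleMap z r t)) :=
      continuous_iff_continuousAt.2 fun t ↦
        ((hP t).2.2.2.2.comp (f := circleMap z r) hcc.continuousAt).clog (hP t).2.2.1
    fun_prop
  · obtain ⟨h1, h2, h3, -⟩ := hP t
    simp only [Complex.exp_add, Complex.exp_log hC, Complex.exp_nat_mul, Complex.exp_log hr0,
      Complex.exp_log (Complex.slitPlane_ne_zero h2),
      Complex.exp_log (Complex.slitPlane_ne_zero h3), h1, hcirc]
  · have h1 : circleMap z r (2 * Real.pi) = circleMap z r 0 := by
      simpa using periodic_circleMap z r 0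
    simp only [h1]
    push_cast
    ring

/-- Every real-linear `B` is `w ↦ a w + b w̄`, with `a` and `b` its `∂` and `∂̄` coefficients. Its
determinant is `‖a‖² - ‖b‖² = Im (conj (B 1) · B i)`, so the orientation condition at `w = 1` gives
`‖b‖ < ‖a‖`. -/
theorem exists_conjugate_linear_form {B : ℂ →L[ℝ] ℂ} (hB : B ≠ 0)
    (h : ∀ w, B w ≠ 0 → 0 < ((starRingEnd ℂ) (B w) * B (Complex.I * w)).im) :
    ∃ a b : ℂ, ‖b‖ < ‖a‖ ∧ ∀ w, B w = a * w + b * (starRingEnd ℂ) w := by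
  have hlin : ∀ w : ℂ, B w = w.re * B 1 + w.im * B Complex.I := by
    intro w
    conv_lhs => rw [← Complex.re_add_im w]
    rw [show (w.re : ℂ) + w.im * Complex.I = w.re • (1 : ℂ) + w.im • Complex.I by simp, map_add,
      map_smul, map_smul]
    simp
  have h1 : B 1 ≠ 0 := by
    intro h1
    have h2 : B Complex.I ≠ 0 := fun h2 ↦ hB (ContinuousLinearMap.ext fun w ↦ by simp [hlin w, h1, h2])
    have h3 := h _ h2
    rw [Complex.I_mul_I, map_neg, h1] at h3
    simp at h3
  have h2 := h 1 h1
  refine ⟨(B 1 - Complex.I * B Complex.I) / 2, (B 1 + Complex.I * B Complex.I) / 2, ?_, ?_⟩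
  · refine lt_of_pow_lt_pow_left₀ 2 (norm_nonneg _) ?_
    rw [Complex.sq_norm, Complex.sq_norm]
    simp only [mul_one, Complex.mul_im, Complex.conj_re, Complex.conj_im] at h2
    simp only [map_div₀, Complex.normSq_apply, Complex.add_re, Complex.add_im, Complex.sub_re,
      Complex.sub_im, Complex.mul_re, Complex.mul_im, Complex.I_re, Complex.I_im,
      Complex.re_ofNat, Complex.im_ofNat]
    nlinarith
  · intro w
    rw [hlin w]
    apply Complex.ext <;> simp <;> ring

theorem pos_re_div_of_norm_lt {a b w : ℂ} (hw : w ≠ 0) (hab : ‖b‖ < ‖a‖) :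
    1 - ‖b‖ / ‖a‖ ≤ ((a * w + b * (starRingEnd ℂ) w) / (a * w)).re := by
  have ha : a ≠ 0 := by
    rintro rfl
    simp only [norm_zero] at hab
    exact absurd (norm_nonneg b) (not_le.2 hab)
  have h1 : (a * w + b * (starRingEnd ℂ) w) / (a * w) = 1 + b * (starRingEnd ℂ) w / (a * w) := by
    field_simp
  have h2 : ‖b * (starRingEnd ℂ) w / (a * w)‖ = ‖b‖ / ‖a‖ := by
    rw [norm_div, norm_mul, norm_mul, RCLike.norm_conj, mul_div_mul_right _ _ (norm_ne_zero_iff.2 hw)]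
  have h3 := Complex.abs_re_le_norm (b * (starRingEnd ℂ) w / (a * w))
  rw [h1, Complex.add_re, Complex.one_re]
  rw [h2] at h3
  linarith [(abs_le.1 h3).1]

end Winding

/-! ### Functions vanishing on a complex coordinate hyperplane -/

section TransverseDerivative

open Asymptotics

variable {n : ℕ}

/-- The `i`-th coordinate line. -/
noncomputable def coordLine (i : Fin n) : ℂ →L[ℝ] Cn n :=
  ((ContinuousLinearMap.id ℂ ℂ).smulRight (EuclideanSpace.single i (1 : ℂ))).restrictScalars ℝ

theorem coordLine_apply (i : Fin n) (w : ℂ) :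
    coordLine i w = w • (EuclideanSpace.single i (1 : ℂ) : Cn n) := rfl

theorem coordLine_self (i : Fin n) (w : ℂ) : coordLine i w i = w := by
  simp [coordLine_apply]

theorem coordLine_I_mul (i : Fin n) (w : ℂ) :
    coordLine i (Complex.I * w) = Complex.I • coordLine i w := by
  simp [coordLine_apply, mul_smul]

/-- Compare `y` with its projection to the hyperplane `y i = 0`, where `F` vanishes. Both points
move, so the strict derivative is needed; in return the error is small relative to the distance `‖y
i‖` to the hyperplane rather than to `‖y - y₀‖`. -/
theorem isLittleO_of_zero_on_hyperplane {F : Cn n → ℂ} {A : Cn n →L[ℝ] ℂ} {y₀ : Cn n} {i : Fin n}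
    (hF : HasStrictFDerivAt F A y₀) (hi : y₀ i = 0) (h0 : ∀ᶠ y in 𝓝 y₀, y i = 0 → F y = 0) :
    (fun y ↦ F y - A (coordLine i (y i))) =o[𝓝 y₀] fun y ↦ y i := by
  have hc : Continuous fun y : Cn n ↦ y - coordLine i (y i) :=
    continuous_id.sub ((coordLine i).continuous.comp (BlowUp.contDiff_apply_real i).continuous)
  have ht : Tendsto (fun y : Cn n ↦ y - coordLine i (y i)) (𝓝 y₀) (𝓝 y₀) := by
    have := hc.tendsto y₀
    rwa [hi, map_zero, sub_zero] at this
  have h1 := hF.isLittleO.comp_tendsto (tendsto_id.prodMk_nhds ht)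
  refine (h1.congr' ?_ EventuallyEq.rfl).trans_isBigO ?_
  · filter_upwards [ht.eventually h0] with y hy
    have := hy (by simp [coordLine_self])
    simp [this]
  · refine IsBigO.of_bound 1 (Eventually.of_forall fun y ↦ ?_)
    simp [coordLine_apply, norm_smul]

theorem fderiv_eq_of_zero_on_hyperplane {F : Cn n → ℂ} {A : Cn n →L[ℝ] ℂ} {y₀ : Cn n} {i : Fin n}
    (hF : HasStrictFDerivAt F A y₀) (hi : y₀ i = 0) (h0 : ∀ᶠ y in 𝓝 y₀, y i = 0 → F y = 0)
    (v : Cn n) : A v = A (coordLine i (v i)) := by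
  have h1 := isLittleO_of_zero_on_hyperplane hF hi h0
  let P : Cn n →L[ℝ] ℂ := (EuclideanSpace.proj i : Cn n →L[ℂ] ℂ).restrictScalars ℝ
  have h2 : HasFDerivAt F (A ∘L coordLine i ∘L P) y₀ := by
    rw [hasFDerivAt_iff_isLittleO]
    have hF0 : F y₀ = 0 := h0.self_of_nhds hi
    refine (h1.congr_left fun y ↦ ?_).trans_isBigO ?_
    · simp [hF0, P, hi]
    · refine IsBigO.of_bound 1 (Eventually.of_forall fun y ↦ ?_)
      have := PiLp.norm_apply_le (y - y₀) i
      simpa [hi] using this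
  exact DFunLike.congr_fun (hF.hasFDerivAt.unique h2) v

/-- To first order `F` is `a (y i) + b conj (y i)` with `‖b‖ < ‖a‖`, so `F / (a y i)` is `1` plus a
term of modulus `‖b‖ / ‖a‖ < 1` plus a small error. Thus `F` can be replaced by `a (y i)` when
computing winding numbers. -/
theorem eventually_pos_re_of_zero_on_hyperplane {F : Cn n → ℂ} {A : Cn n →L[ℝ] ℂ} {y₀ : Cn n}
    {i : Fin n} (hF : HasStrictFDerivAt F A y₀) (hi : y₀ i = 0)
    (h0 : ∀ᶠ y in 𝓝 y₀, y i = 0 → F y = 0) (hA : Function.Surjective A)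
    (hor : ∀ w, A (coordLine i w) ≠ 0 → 0 < ((starRingEnd ℂ) (A (coordLine i w)) *
      A (coordLine i (Complex.I * w))).im) :
    ∃ a : ℂ, a ≠ 0 ∧ ∀ᶠ y in 𝓝 y₀, y i ≠ 0 → 0 < (F y / (a * y i)).re := by
  have hB : A ∘L coordLine i ≠ 0 := by
    intro hB
    obtain ⟨v, hv⟩ := hA 1
    rw [fderiv_eq_of_zero_on_hyperplane hF hi h0] at hv
    have := DFunLike.congr_fun hB (v i)
    simp [hv] at this
  obtain ⟨a, b, hab, hlin⟩ := exists_conjugate_linear_form hB hor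
  have ha : 0 < ‖a‖ := (norm_nonneg b).trans_lt hab
  have ha0 : a ≠ 0 := norm_pos_iff.1 ha
  refine ⟨a, ha0, ?_⟩
  have hpos : 0 < 1 - ‖b‖ / ‖a‖ := sub_pos.2 ((div_lt_one ha).2 hab)
  -- After division by `a (y i)`, this error uses up at most half of the lower bound `1 - ‖b‖ /
  -- ‖a‖`.
  have hε : 0 < (‖a‖ * (1 - ‖b‖ / ‖a‖)) / 2 := by positivity
  filter_upwards [(isLittleO_of_zero_on_hyperplane hF hi h0).bound hε] with y hy hyi
  have hlin' : A (coordLine i (y i)) = a * y i + b * (starRingEnd ℂ) (y i) := hlin (y i)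
  have h1 := pos_re_div_of_norm_lt hyi hab
  rw [← hlin'] at h1
  have h2 : F y / (a * y i) = A (coordLine i (y i)) / (a * y i) +
      (F y - A (coordLine i (y i))) / (a * y i) := by ring
  have h3 : ‖(F y - A (coordLine i (y i))) / (a * y i)‖ ≤ (1 - ‖b‖ / ‖a‖) / 2 := by
    have hn : 0 < ‖a * y i‖ := norm_pos_iff.2 (mul_ne_zero ha0 hyi)
    rw [norm_div, div_le_iff₀ hn, norm_mul]
    exact hy.trans (le_of_eq (by ring))
  have h4 := (abs_le.1 (Complex.abs_re_le_norm
    ((F y - A (coordLine i (y i))) / (a * y i)))).1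
  rw [h2, Complex.add_re]
  linarith

end TransverseDerivative

/-! ### Intersection of the lift with the exceptional divisor -/

namespace BlowUp

variable {n : ℕ} {X : Type*} [TopologicalSpace X] [ChartedSpace (Cn n) X]

theorem mem_exceptional_iff (ι : BallEmbedding n X) {p : BlowUp ι} :
    p ∈ exceptional ι ↔ proj ι p = ι.center := Iff.rfl

variable [IsManifold 𝓘(ℝ, Cn n) ∞ X] [T2Space X] (ι : BallEmbedding n X)
  {J : AlmostComplexStructure n X}

theorem mem_exceptional_iff_nearChart {i : Fin n} {p : BlowUp ι}
    (hp : p ∈ (nearChart ι i).source) : p ∈ exceptional ι ↔ nearChart ι i p i = 0 := by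
  have hs := ι.mem_source ((nearChart ι i).map_source hp)
  rw [mem_exceptional_iff, proj_eq_nearChart ι hp, ← down_eq_zero (i := i)]
  constructor
  · intro h
    exact ι.map.injOn hs ι.zero_mem_source h
  · intro h; rw [h]; rfl

/-- The differential of the coordinate is complex linear for the structure of the blow up, so the
orientation expression equals `‖A v‖² > 0`. This shows that oriented defining functions exist. -/
theorem isDefiningFunctionAt_nearChart (hJ : ι.PullsBackToStandard J) {i : Fin n} {p : BlowUp ι}
    (hp : p ∈ (nearChart ι i).source) :
    IsDefiningFunctionAt (almostComplexStructure ι hJ) (exceptional ι) p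
      (fun q ↦ nearChart ι i q i) := by
  have hsm : ContMDiffOn 𝓘(ℝ, Cn n) 𝓘(ℝ, ℂ) ∞ (fun q ↦ nearChart ι i q i)
      (nearChart ι i).source :=
    (contDiff_apply_real i).contMDiff.comp_contMDiffOn
      (contMDiffOn_of_mem_maximalAtlas (nearChart_mem ι i))
  refine ⟨(nearChart ι i).source, (nearChart ι i).open_source, hp, hsm,
    fun q hq ↦ mem_exceptional_iff_nearChart ι hq, fun q hq _ ↦ ?_⟩
  have hd : ∀ v : Cn n, modelDeriv (E := Cn n) (E' := ℂ) (fun q ↦ nearChart ι i q i) q v =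
      dnear ι i q v i := by
    intro v
    have h1 := modelDeriv_comp (E := Cn n) (E' := Cn n) (E'' := ℂ) q
      (g := fun y : Cn n ↦ y i) (f := nearChart ι i)
      ((contDiff_apply_real i).contMDiff.mdifferentiableAt (by simp))
      ((mdifferentiable_of_mem_maximalAtlas (nearChart_mem ι i)).mdifferentiableAt hq)
    rw [modelDeriv_eq_fderiv] at h1
    have h2 : fderiv ℝ (fun y : Cn n ↦ y i) (nearChart ι i q) =
        (EuclideanSpace.proj i : Cn n →L[ℂ] ℂ).restrictScalars ℝ :=
      ((EuclideanSpace.proj i : Cn n →L[ℂ] ℂ).restrictScalars ℝ).fderiv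
    rw [h1, h2]
    rfl
  change Function.Surjective (modelDeriv (E := Cn n) (E' := ℂ) (fun q ↦ nearChart ι i q i) q) ∧
    ∀ v : Cn n, modelDeriv (E := Cn n) (E' := ℂ) (fun q ↦ nearChart ι i q i) q v ≠ 0 →
      0 < ((starRingEnd ℂ) (modelDeriv (E := Cn n) (E' := ℂ) (fun q ↦ nearChart ι i q i) q v) *
        modelDeriv (E := Cn n) (E' := ℂ) (fun q ↦ nearChart ι i q i) q (structureFun ι J q v)).im
  refine ⟨fun c ↦ ⟨dnearSymm ι i (nearChart ι i q) (coordLine i c), ?_⟩, fun v hv ↦ ?_⟩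
  · rw [hd, dnear_dnearSymm ι hq, coordLine_self]
  · rw [hd] at hv
    rw [hd, hd, dnear_structureFun ι hJ hq, PiLp.smul_apply, smul_eq_mul, mul_left_comm,
      ← Complex.normSq_eq_conj_mul_self]
    simpa using Complex.normSq_pos.2 hv

theorem hasStrictFDerivAt_definingFunction {f : BlowUp ι → ℂ} {p : BlowUp ι} {i : Fin n}
    (hp : p ∈ (nearChart ι i).source) (hf : ContMDiffAt 𝓘(ℝ, Cn n) 𝓘(ℝ, ℂ) ∞ f p) :
    HasStrictFDerivAt (fun y ↦ f ((nearChart ι i).symm y))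
      (modelDeriv (E := Cn n) (E' := ℂ) f p ∘L dnearSymm ι i (nearChart ι i p))
      (nearChart ι i p) := by
  have ht := (nearChart ι i).map_source hp
  have hl := (nearChart ι i).left_inv hp
  have h1 : ContDiffAt ℝ ∞ (fun y ↦ f ((nearChart ι i).symm y)) (nearChart ι i p) := by
    rw [← contMDiffAt_iff_contDiffAt]
    refine ContMDiffAt.comp _ (g := f) (by rwa [hl])
      (contMDiffAt_symm_of_mem_maximalAtlas (nearChart_mem ι i) ht)
  have h2 := modelDeriv_comp (E := Cn n) (E' := Cn n) (E'' := ℂ) (nearChart ι i p)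
    (g := f) (f := (nearChart ι i).symm) (by rw [hl]; exact hf.mdifferentiableAt (by simp))
    ((mdifferentiable_of_mem_maximalAtlas (nearChart_mem ι i)).mdifferentiableAt_symm ht)
  rw [modelDeriv_eq_fderiv, hl] at h2
  have h3 := h1.hasStrictFDerivAt (by simp)
  rw [h2] at h3
  exact h3

/-- In an affine chart the lift has `i`-th coordinate `(w - z)^k h_i(w)`, and an oriented defining
function is `a` times that coordinate up to a factor of positive real part. The winding number is
therefore `k`, whichever defining function is used. -/
theorem hasLocalIntersectionIndex_of_lift (hJ : ι.PullsBackToStandard J) {u : ℂ → X}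
    {v : ℂ → BlowUp ι} {z : ℂ} {k : ℕ} {h : ℂ → Cn n} (hv : ∀ᶠ w in 𝓝 z, ContinuousAt v w)
    (hproj : ∀ᶠ w in 𝓝 z, proj ι (v w) = u w) (hz : u z = ι.center)
    (hf : HasLeadingFactor (fun w ↦ ι.map.symm (u w)) z k h) :
    HasLocalIntersectionIndex (almostComplexStructure ι hJ) (exceptional ι) v z k := by
  have hvz := eq_line_of_lift ι hv.self_of_nhds hproj hz hf
  have hvc := hv.self_of_nhds
  obtain ⟨i, hi⟩ := exists_rep_ne_zero (Projectivization.mk ℂ (h z) hf.ne_zero)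
  have hp : v z ∈ (nearChart ι i).source := by
    rw [hvz]; exact (line_mem_nearChart_source ι).2 hi
  refine ⟨⟨_, isDefiningFunctionAt_nearChart ι hJ hp⟩, ?_⟩
  rintro f ⟨U, hU, hzU, hfU, hfE, hfd⟩
  have hzE : v z ∈ exceptional ι := by rw [hvz]; rfl
  have hy₀ := (mem_exceptional_iff_nearChart ι hp).1 hzE
  obtain ⟨hsurj, hor⟩ := hfd (v z) hzU hzE
  change Function.Surjective (modelDeriv (E := Cn n) (E' := ℂ) f (v z)) at hsurj
  replace hor : ∀ w : Cn n, modelDeriv (E := Cn n) (E' := ℂ) f (v z) w ≠ 0 →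
      0 < ((starRingEnd ℂ) (modelDeriv (E := Cn n) (E' := ℂ) f (v z) w) *
        modelDeriv (E := Cn n) (E' := ℂ) f (v z) (structureFun ι J (v z) w)).im := hor
  have hF := hasStrictFDerivAt_definingFunction ι hp (hfU.contMDiffAt (hU.mem_nhds hzU))
  have ht := (nearChart ι i).map_source hp
  have hl := (nearChart ι i).left_inv hp
  have hF0 : ∀ᶠ y in 𝓝 (nearChart ι i (v z)), y i = 0 → f ((nearChart ι i).symm y) = 0 := by
    have h1 : ∀ᶠ y in 𝓝 (nearChart ι i (v z)), (nearChart ι i).symm y ∈ U :=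
      ((nearChart ι i).symm.continuousAt ht).eventually (by rw [hl]; exact hU.mem_nhds hzU)
    filter_upwards [h1, (nearChart ι i).open_target.mem_nhds ht] with y h1 h2 h3
    rw [← hfE _ h1, mem_exceptional_iff_nearChart ι ((nearChart ι i).map_target h2),
      (nearChart ι i).right_inv h2, h3]
  have hst : ∀ w, structureFun ι J (v z) (dnearSymm ι i (nearChart ι i (v z)) w) =
      dnearSymm ι i (nearChart ι i (v z)) (Complex.I • w) := by
    intro w
    have := structureFun_dnearSymm ι hJ ht w
    rwa [hl] at this
  obtain ⟨a, ha, hpos⟩ := eventually_pos_re_of_zero_on_hyperplane hF hy₀ hF0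
    (fun c ↦ by
      obtain ⟨w, hw⟩ := hsurj c
      exact ⟨dnear ι i (v z) w, by simpa [dnearSymm_dnear ι hp] using hw⟩)
    (fun w hw ↦ by
      have h1 := hor (dnearSymm ι i (nearChart ι i (v z)) (coordLine i w)) hw
      rw [hst, ← coordLine_I_mul] at h1
      exact h1)
  have hhi : h z i ≠ 0 := ne_zero_of_lift ι hvc hproj hf hp
  have hcoord := (nearChart_apply_of_lift ι hvc hproj hf hp).1
  have hic : ∀ᶠ w in 𝓝 z, ContinuousAt (fun w ↦ h w i) w :=
    hf.analyticAt.eventually_analyticAt.mono fun w hw ↦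
      (EuclideanSpace.proj i : Cn n →L[ℂ] ℂ).continuous.continuousAt.comp hw.continuousAt
  -- The factor `p` tends to `1` at `z`; the factor `q` has positive real part by `hpos`. Neither
  -- winds around `0`.
  refine eventually_hasWindingNumber (φ := fun w ↦ f (v w)) (C := a * h z i)
    (p := fun w ↦ h w i / h z i) (q := fun w ↦ f (v w) / (a * ((w - z) ^ k * h w i)))
    (mul_ne_zero ha hhi) ?_
  have hnear : ContinuousAt (fun w ↦ nearChart ι i (v w)) z :=
    ((nearChart ι i).continuousAt hp).comp hvc
  have hratio : ∀ᶠ w in 𝓝 z, h w i / h z i ∈ Complex.slitPlane := by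
    refine (hic.self_of_nhds.div_const (h z i)).eventually
      (Complex.isOpen_slitPlane.mem_nhds ?_)
    change h z i / h z i ∈ _
    rw [div_self hhi]
    exact Complex.one_mem_slitPlane
  filter_upwards [self_mem_nhdsWithin, nhdsWithin_le_nhds hcoord, nhdsWithin_le_nhds hv,
    nhdsWithin_le_nhds hic, nhdsWithin_le_nhds hratio,
    nhdsWithin_le_nhds (hic.self_of_nhds.eventually_ne hhi),
    nhdsWithin_le_nhds (hvc (hU.mem_nhds hzU)),
    nhdsWithin_le_nhds (hvc ((nearChart ι i).open_source.mem_nhds hp)),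
    nhdsWithin_le_nhds (hnear.eventually hpos)] with w hwz hwc hwv hwh hwr hwi hwU hwn hwp
  have hwz' : (w - z) ^ k ≠ 0 := pow_ne_zero _ (sub_ne_zero.2 hwz)
  have hden : a * ((w - z) ^ k * h w i) ≠ 0 := mul_ne_zero ha (mul_ne_zero hwz' hwi)
  have hl' : (nearChart ι i).symm (nearChart ι i (v w)) = v w := (nearChart ι i).left_inv hwn
  have hfc : ContinuousAt (fun w ↦ f (v w)) w :=
    ((hfU.continuousOn.continuousAt (hU.mem_nhds hwU))).comp (f := v) hwv
  refine ⟨?_, hwr, ?_, hwh.div_const _, hfc.div ?_ hden⟩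
  · field_simp
  · rw [hwc, hl'] at hwp
    exact Or.inl (hwp (mul_ne_zero hwz' hwi))
  · exact continuousAt_const.mul (((continuousAt_id.sub continuousAt_const).pow k).mul hwh)

theorem hasIntersectionNumber_of_lift (hJ : ι.PullsBackToStandard J) {u : ℂ → X} {L : Set X}
    (hu : IsHolomorphicDisk J L u) (hL : ι.center ∉ L) {v : ℂ → BlowUp ι}
    (hvc : ContinuousOn v unitDisk) (hv : ∀ z ∈ unitDisk, proj ι (v z) = u z) {k : ℕ}
    (hk : HasMultiplicity ι u k) :
    HasIntersectionNumber (almostComplexStructure ι hJ) (exceptional ι) v k := by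
  obtain ⟨S, hS, hsum⟩ := hk
  have hmem : ∀ z ∈ unitDisk, v z ∈ exceptional ι ↔ u z = ι.center := fun z hz ↦ by
    rw [mem_exceptional_iff, hv z hz]
  -- The local index is the order of vanishing as a natural number. The default value `0` for
  -- infinite order never occurs on `S`, where `exists_leadingFactor` gives finite orders.
  refine ⟨fun z hz h ↦ ?_, S, fun z ↦ (hS z).trans (and_congr_right fun hz ↦ (hmem z hz).symm),
    fun z ↦ (analyticOrderNatAt (fun w ↦ ι.map.symm (u w)) z : ℕ), fun z hz ↦ ?_, ?_⟩
  · rw [hmem z (Metric.sphere_subset_closedBall hz)] at h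
    exact hL (h ▸ hu.boundary z hz)
  · obtain ⟨hzD, hzc⟩ := (hS z).1 hz
    obtain ⟨m, hm, h, hf⟩ := hu.exists_leadingFactor hJ hL hzD hzc
    have hb := hu.mem_ball_of_eq_center hL hzD hzc
    have hm' : analyticOrderNatAt (fun w ↦ ι.map.symm (u w)) z = m := by
      simp [analyticOrderNatAt, hm]
    simp only [hm']
    refine hasLocalIntersectionIndex_of_lift ι hJ ?_ (eventually_of_mem (unitDisk_mem_nhds hb) hv)
      hzc hf
    filter_upwards [Metric.isOpen_ball.mem_nhds hb] with w hw
    exact hvc.continuousAt (unitDisk_mem_nhds hw)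
  · have h1 : ∀ z ∈ S, analyticOrderAt (fun w ↦ ι.map.symm (u w)) z =
        (analyticOrderNatAt (fun w ↦ ι.map.symm (u w)) z : ℕ) := by
      intro z hz
      obtain ⟨hzD, hzc⟩ := (hS z).1 hz
      obtain ⟨m, hm, -⟩ := hu.exists_leadingFactor hJ hL hzD hzc
      simp [analyticOrderNatAt, hm]
    rw [Finset.sum_congr rfl h1] at hsum
    change ∑ z ∈ S, (analyticOrderNatAt (fun w ↦ ι.map.symm (u w)) z : ℤ) = k
    exact_mod_cast hsum

theorem exists_hasMultiplicity (hJ : ι.PullsBackToStandard J) {u : ℂ → X} {L : Set X}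
    (hu : IsHolomorphicDisk J L u) (hL : ι.center ∉ L) : ∃ k : ℕ, HasMultiplicity ι u k := by
  have hfin := hu.finite_preimage_center hJ hL
  refine ⟨∑ z ∈ hfin.toFinset, analyticOrderNatAt (fun w ↦ ι.map.symm (u w)) z, hfin.toFinset,
    fun z ↦ by simp, ?_⟩
  push_cast
  refine Finset.sum_congr rfl fun z hz ↦ ?_
  obtain ⟨hzD, hzc⟩ := hfin.mem_toFinset.1 hz
  obtain ⟨m, hm, -⟩ := hu.exists_leadingFactor hJ hL hzD hzc
  simp [analyticOrderNatAt, hm]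

end BlowUp

/-! ### The blow up theorem for holomorphic disks -/

theorem propositionp {n : ℕ} (hn : 2 ≤ n)
    {M : Type*} [TopologicalSpace M] [T2Space M] [ChartedSpace (Cn n) M]
    [IsManifold 𝓘(ℝ, Cn n) ∞ M]
    (Ω : SymplecticForm n M) (J : AlmostComplexStructure n M) (hJ : Ω.Compatible J)
    (ι : BallEmbedding n M) (hι : ι.IsSymplectic Ω) (hιJ : ι.PullsBackToStandard J)
    (L : Set M) (hL : Ω.IsLagrangian L)
    (hdisj : Disjoint L (ι.map '' Metric.closedBall 0 ι.radius)) :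
    ∃ J' : AlmostComplexStructure n (BlowUp ι),
      IsHolomorphicMap J' J (BlowUp.proj ι) ∧
      (∀ J'' : AlmostComplexStructure n (BlowUp ι),
        IsHolomorphicMap J'' J (BlowUp.proj ι) → J'' = J') ∧
      ∀ u : ℂ → M, IsHolomorphicDisk J L u → (¬ ∃ x, ∀ z ∈ unitDisk, u z = x) →
        (∃ v : ℂ → BlowUp ι,
          (IsHolomorphicDisk J' (BlowUp.proj ι ⁻¹' L) v ∧
            ∀ z ∈ unitDisk, BlowUp.proj ι (v z) = u z) ∧
          ∀ w : ℂ → BlowUp ι,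
            (IsHolomorphicDisk J' (BlowUp.proj ι ⁻¹' L) w ∧
              ∀ z ∈ unitDisk, BlowUp.proj ι (w z) = u z) → EqOn w v unitDisk) ∧
        (∃ k : ℕ, HasMultiplicity ι u k) ∧
        ∀ v : ℂ → BlowUp ι,
          (IsHolomorphicDisk J' (BlowUp.proj ι ⁻¹' L) v ∧
            ∀ z ∈ unitDisk, BlowUp.proj ι (v z) = u z) →
          ∀ k : ℕ, HasMultiplicity ι u k →
            HasIntersectionNumber J' (BlowUp.exceptional ι) v k := by
  -- Disjointness from the ball enters only through its centre: no boundary point of a disk maps to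
  -- `x₀`.
  have hc : ι.center ∉ L := fun h ↦
    disjoint_left.1 hdisj h ⟨0, Metric.mem_closedBall_self ι.radius_pos.le, rfl⟩
  refine ⟨BlowUp.almostComplexStructure ι hιJ, BlowUp.isHolomorphicMap_proj ι hιJ,
    fun J'' h ↦ BlowUp.eq_almostComplexStructure ι hιJ h, fun u hu _ ↦ ⟨?_,
      BlowUp.exists_hasMultiplicity ι hιJ hu hc, fun v hv k hk ↦
        BlowUp.hasIntersectionNumber_of_lift ι hιJ hu hc hv.1.smooth.continuousOn hv.2 hk⟩⟩
  obtain ⟨v, hv, hvu⟩ := BlowUp.exists_lift_disk ι hιJ hu hc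
  exact ⟨v, ⟨hv, hvu⟩, fun w hw ↦ BlowUp.lift_disk_unique ι hιJ hu hc hv.smooth.continuousOn
    hw.1.smooth.continuousOn hvu hw.2⟩
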